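/- Let $N\ge 3$ and let $\mathbb{B}^N=\{x\in\mathbb{R}^N:|x|<1\}$ be the Poincaré ball with metric $g=\rho^2\,g_{\mathrm{eucl}}$, $\rho(x)=\frac{2}{1-|x|^2}$, volume $dV=\rho^N\,dx$, and geodesic distance to the origin $d(x)=\log\frac{1+|x|}{1-|x|}$. Let $H^1(\mathbb{B}^N)$ be the space of real functions $u\in L^2(\mathbb{B}^N,dV)$ that have a weak gradient $\nabla u$ on $\mathbb{B}^N$ with $\nabla_{\mathbb{B}^N}u:=\rho^{-1}\nabla u\in L^2(\mathbb{B}^N,dV)$, and let $H^1_r(\mathbb{B}^N)$ be its subspace of radial functions (functions of $|x|$ only). Endow $H=H^1_r(\mathbb{B}^N)\times H^1_r(\mathbb{B}^N)$ with the norm $$\|(u,v)\|^2=\int_{\mathbb{B}^N}\bigl(|\nabla_{\mathbb{B}^N}u|^2+|\nabla_{\mathbb{B}^N}v|^2\bigr)\,dV,$$ where $|\cdot|$ is the Euclidean norm, and $L^p(\mathbb{B}^N)\times L^p(\mathbb{B}^N)$, with $L^p(\mathbb{B}^N)=L^p(\mathbb{B}^N,dV)$, with the norm $\|(u,v)\|_p^p=\int_{\mathbb{B}^N}(|u|^p+|v|^p)\,dV$.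 Let $m>0$, let $\tilde m=\frac{2N}{N-2-2m}$ if $m<\frac{N-2}{2}$ and $\tilde m=\infty$ otherwise, and let $p\in(2,\tilde m)$ be real. Then $(u,v)\mapsto(d(x)^m u,\,d(x)^m v)$ is a well-defined compact (in particular continuous) linear operator from $H$ to $L^p(\mathbb{B}^N)\times L^p(\mathbb{B}^N)$. -/

import Mathlib

open MeasureTheory Set Metric
open scoped ENNReal ContDiff

noncomputable section

namespace Hyperbolic

/-- `ℝ^N` with its Euclidean structure. -/
abbrev Eu (N : ℕ) : Type := EuclideanSpace ℝ (Fin N)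

/-- The underlying set `{x : |x| < 1}` of the Poincaré ball. -/
abbrev unitBall (N : ℕ) : Set (Eu N) := ball 0 1

/-- The conformal factor `ρ(x) = 2 / (1 - |x|²)`; the metric is `g = ρ² · (Euclidean metric)`. -/
def conf {N : ℕ} (x : Eu N) : ℝ := 2 / (1 - ‖x‖ ^ 2)

/-- The hyperbolic volume `dV = ρ^N dx` on the unit ball. -/
def hypVol (N : ℕ) : Measure (Eu N) :=
  (volume.restrict (unitBall N)).withDensity fun x => ENNReal.ofReal (conf x ^ N)

/-- The geodesic distance `d(x) = ∫_0^{|x|} 2 / (1 - s²) ds = log ((1 + |x|) / (1 - |x|))`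
from the origin to a point `x` of the Poincaré ball. -/
def hypDist {N : ℕ} (x : Eu N) : ℝ := Real.log ((1 + ‖x‖) / (1 - ‖x‖))

/-- `G` is the Euclidean weak gradient of `u` in the unit ball:
`∫ u ∇φ dx = - ∫ φ G dx` for all `φ ∈ C_c^∞`. -/
structure HasWeakGradient {N : ℕ} (u : Eu N → ℝ) (G : Eu N → Eu N) : Prop where
  locInt : LocallyIntegrableOn u (unitBall N) volume
  locInt_grad : LocallyIntegrableOn G (unitBall N) volume
  integral_eq : ∀ φ : Eu N → ℝ, ContDiff ℝ ∞ φ → HasCompactSupport φ →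
    tsupport φ ⊆ unitBall N →
      ∫ x in unitBall N, u x • gradient φ x = - ∫ x in unitBall N, φ x • G x

theorem conf_pos {N : ℕ} {x : Eu N} (hx : x ∈ unitBall N) : 0 < conf x := by
  have h : ‖x‖ < 1 := by simpa using hx
  have h0 := norm_nonneg x
  unfold conf
  apply div_pos two_pos
  nlinarith

theorem hypVol_ac (N : ℕ) : hypVol N ≪ volume.restrict (unitBall N) :=
  withDensity_absolutelyContinuous _ _

theorem ac_hypVol (N : ℕ) : volume.restrict (unitBall N) ≪ hypVol N := by
  refine withDensity_absolutelyContinuous' ?_ ?_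
  · have : Measurable fun x : Eu N => conf x ^ N := by unfold conf; fun_prop
    exact this.ennreal_ofReal.aemeasurable
  · refine (ae_restrict_mem measurableSet_ball).mono fun x hx => ?_
    exact (ENNReal.ofReal_pos.2 (pow_pos (conf_pos hx) N)).ne'

theorem integrable_smul_of_test {N : ℕ} {F : Type*} [NormedAddCommGroup F] [NormedSpace ℝ F]
    {φ : Eu N → ℝ} {f : Eu N → F} (hφ : Continuous φ) (hc : HasCompactSupport φ)
    (hs : tsupport φ ⊆ unitBall N) (hf : LocallyIntegrableOn f (unitBall N) volume) :
    Integrable (fun x => φ x • f x) := by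
  have h1 : IntegrableOn f (tsupport φ) := hf.integrableOn_compact_subset hs hc
  have h2 : IntegrableOn (fun x => φ x • f x) (tsupport φ) :=
    h1.continuousOn_smul hφ.continuousOn hc
  refine (integrableOn_iff_integrable_of_support_subset ?_).1 h2
  exact (Function.support_smul_subset_left φ f).trans (subset_tsupport φ)

theorem integrable_smul_gradient {N : ℕ} {φ : Eu N → ℝ} {u : Eu N → ℝ} (hφ : ContDiff ℝ ∞ φ)
    (hc : HasCompactSupport φ) (hs : tsupport φ ⊆ unitBall N)
    (hu : LocallyIntegrableOn u (unitBall N) volume) :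
    Integrable (fun x => u x • gradient φ x) := by
  have h1 : IntegrableOn u (tsupport φ) := hu.integrableOn_compact_subset hs hc
  have hcont : Continuous (gradient φ) :=
    (InnerProductSpace.toDual ℝ (Eu N)).symm.continuous.comp (hφ.continuous_fderiv (by simp))
  have h2 : IntegrableOn (fun x => u x • gradient φ x) (tsupport φ) :=
    h1.smul_continuousOn hcont.continuousOn hc
  refine (integrableOn_iff_integrable_of_support_subset ?_).1 h2
  intro x hx
  by_contra hxs
  apply hx
  have : fderiv ℝ φ x = 0 := by
    by_contra h
    exact hxs (support_fderiv_subset ℝ h)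
  simp [gradient, this]

theorem HasWeakGradient.ae_unique {N : ℕ} {u v : Eu N → ℝ} {G G' : Eu N → Eu N}
    (h : HasWeakGradient u G) (h' : HasWeakGradient v G')
    (huv : u =ᵐ[volume.restrict (unitBall N)] v) :
    G =ᵐ[volume.restrict (unitBall N)] G' := by
  have key : ∀ᵐ x ∂(volume : Measure (Eu N)), x ∈ unitBall N → G x - G' x = 0 := by
    refine isOpen_ball.ae_eq_zero_of_integral_contDiff_smul_eq_zero
      (h.locInt_grad.sub h'.locInt_grad) fun φ hφ hc hs => ?_
    have e := h.integral_eq φ hφ hc hs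
    have e' := h'.integral_eq φ hφ hc hs
    have e'' : ∫ x in unitBall N, u x • gradient φ x = ∫ x in unitBall N, v x • gradient φ x :=
      integral_congr_ae (huv.mono fun x hx => by simp only [hx])
    have i := integrable_smul_of_test hφ.continuous hc hs h.locInt_grad
    have i' := integrable_smul_of_test hφ.continuous hc hs h'.locInt_grad
    have z : ∀ F : Eu N → Eu N,
        ∫ x in unitBall N, φ x • F x = ∫ x, φ x • F x := fun F => by
      refine setIntegral_eq_integral_of_forall_compl_eq_zero fun x hx => ?_
      rw [image_eq_zero_of_notMem_tsupport fun hx' => hx (hs hx'), zero_smul]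
    rw [z] at e e'
    simp only [smul_sub]
    rw [integral_sub i i', sub_eq_zero]
    exact neg_injective (e.symm.trans (e''.trans e'))
  rw [Filter.EventuallyEq, ae_restrict_iff' measurableSet_ball]
  exact key.mono fun x hx hm => sub_eq_zero.1 (hx hm)

theorem HasWeakGradient.congr {N : ℕ} {u v : Eu N → ℝ} {G : Eu N → Eu N}
    (h : HasWeakGradient u G) (huv : u =ᵐ[volume.restrict (unitBall N)] v) :
    HasWeakGradient v G where
  locInt := by
    have h0 := h.locInt
    rw [locallyIntegrableOn_iff isOpen_ball.isLocallyClosed] at h0 ⊢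
    exact fun k hk hc => (h0 k hk hc).congr_fun_ae (ae_restrict_of_ae_restrict_of_subset hk huv)
  locInt_grad := h.locInt_grad
  integral_eq φ hφ hc hs := by
    rw [← h.integral_eq φ hφ hc hs]
    exact integral_congr_ae (huv.mono fun x hx => by simp only [hx])

theorem HasWeakGradient.add {N : ℕ} {u v : Eu N → ℝ} {G G' : Eu N → Eu N}
    (h : HasWeakGradient u G) (h' : HasWeakGradient v G') :
    HasWeakGradient (u + v) (G + G') where
  locInt := h.locInt.add h'.locInt
  locInt_grad := h.locInt_grad.add h'.locInt_grad
  integral_eq φ hφ hc hs := by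
    simp only [Pi.add_apply, add_smul, smul_add]
    rw [integral_add (integrable_smul_gradient hφ hc hs h.locInt).integrableOn
        (integrable_smul_gradient hφ hc hs h'.locInt).integrableOn,
      integral_add (integrable_smul_of_test hφ.continuous hc hs h.locInt_grad).integrableOn
        (integrable_smul_of_test hφ.continuous hc hs h'.locInt_grad).integrableOn,
      h.integral_eq φ hφ hc hs, h'.integral_eq φ hφ hc hs, neg_add]

theorem HasWeakGradient.smul {N : ℕ} {u : Eu N → ℝ} {G : Eu N → Eu N} (c : ℝ)
    (h : HasWeakGradient u G) : HasWeakGradient (c • u) (c • G) where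
  locInt := h.locInt.smul c
  locInt_grad := h.locInt_grad.smul c
  integral_eq φ hφ hc hs := by
    simp only [Pi.smul_apply, smul_assoc, smul_comm _ c]
    rw [integral_smul, integral_smul, h.integral_eq φ hφ hc hs, smul_neg]

theorem HasWeakGradient.zero (N : ℕ) :
    HasWeakGradient (0 : Eu N → ℝ) (0 : Eu N → Eu N) where
  locInt := locallyIntegrableOn_zero
  locInt_grad := locallyIntegrableOn_zero
  integral_eq φ _ _ _ := by simp

/-- `G` is the Euclidean weak gradient of `u`, and the hyperbolic gradient `G / ρ` is
square-integrable for the hyperbolic volume. -/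
def IsH1Gradient {N : ℕ} (u : Eu N → ℝ) (G : Eu N → Eu N) : Prop :=
  HasWeakGradient u G ∧ MemLp (fun x => (conf x)⁻¹ • G x) 2 (hypVol N)

/-- The Sobolev space `H¹(𝔹^N)`, as a subspace of `L²(𝔹^N, dV)`. -/
def H1 (N : ℕ) : Submodule ℝ (Lp ℝ 2 (hypVol N)) where
  carrier := {u | ∃ G, IsH1Gradient (u : Eu N → ℝ) G}
  zero_mem' := ⟨0, (HasWeakGradient.zero N).congr
    ((ac_hypVol N).ae_eq (Lp.coeFn_zero ℝ 2 (hypVol N)).symm), by simp⟩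
  add_mem' := by
    rintro u v ⟨G, hG, hG2⟩ ⟨G', hG', hG2'⟩
    refine ⟨G + G', (hG.add hG').congr ((ac_hypVol N).ae_eq (Lp.coeFn_add u v).symm), ?_⟩
    refine (memLp_congr_ae (Filter.Eventually.of_forall fun x => ?_)).1 (hG2.add hG2')
    exact (smul_add _ _ _).symm
  smul_mem' := by
    rintro c u ⟨G, hG, hG2⟩
    refine ⟨c • G, (hG.smul c).congr ((ac_hypVol N).ae_eq (Lp.coeFn_smul c u).symm), ?_⟩
    refine (memLp_congr_ae (Filter.Eventually.of_forall fun x => ?_)).1 (hG2.const_smul c)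
    exact smul_comm c (conf x)⁻¹ (G x)

/-- The hyperbolic gradient `∇_𝔹 u = ∇u / ρ` of `u ∈ H¹(𝔹^N)`, an element of `L²(𝔹^N, dV)`. -/
def hypGrad (N : ℕ) : H1 N →ₗ[ℝ] Lp (Eu N) 2 (hypVol N) where
  toFun u := (Classical.choose_spec u.2).2.toLp
  map_add' u v := by
    have h := (Classical.choose_spec (u + v).2).1.ae_unique
      ((Classical.choose_spec u.2).1.add (Classical.choose_spec v.2).1)
      ((ac_hypVol N).ae_eq (Lp.coeFn_add (u : Lp ℝ 2 (hypVol N)) v))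
    rw [← MemLp.toLp_add]
    refine MemLp.toLp_congr _ _ (((hypVol_ac N).ae_eq h).mono fun x hx => ?_)
    simp only [hx, Pi.add_apply, smul_add]
  map_smul' c u := by
    have h := (Classical.choose_spec (c • u).2).1.ae_unique
      ((Classical.choose_spec u.2).1.smul c)
      ((ac_hypVol N).ae_eq (Lp.coeFn_smul c (u : Lp ℝ 2 (hypVol N))))
    rw [RingHom.id_apply, ← MemLp.toLp_const_smul]
    refine MemLp.toLp_congr _ _ (((hypVol_ac N).ae_eq h).mono fun x hx => ?_)
    simp only [hx, Pi.smul_apply, smul_comm _ c]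

/-- The choice made in `hypGrad` is immaterial: `hypGrad N u = G / ρ` a.e. for every weak
gradient `G` of `u`. -/
theorem hypGrad_ae_eq {N : ℕ} (u : H1 N) {G : Eu N → Eu N}
    (hG : HasWeakGradient ((u : Lp ℝ 2 (hypVol N)) : Eu N → ℝ) G) :
    hypGrad N u =ᵐ[hypVol N] fun x => (conf x)⁻¹ • G x := by
  have h := (Classical.choose_spec u.2).1.ae_unique hG (ae_eq_refl _)
  refine (MemLp.coeFn_toLp (Classical.choose_spec u.2).2).trans ?_
  exact ((hypVol_ac N).ae_eq h).mono fun x hx => by simp only [hx]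

/-- The radial elements of `L²(𝔹^N, dV)`: those depending only on `|x|`. -/
def radial (N : ℕ) : Submodule ℝ (Lp ℝ 2 (hypVol N)) where
  carrier := {u | ∃ f : ℝ → ℝ, Measurable f ∧ u =ᵐ[hypVol N] fun x => f ‖x‖}
  zero_mem' := ⟨0, measurable_const, Lp.coeFn_zero ℝ 2 (hypVol N)⟩
  add_mem' := by
    rintro u v ⟨f, hf, hu⟩ ⟨g, hg, hv⟩
    exact ⟨f + g, hf.add hg, (Lp.coeFn_add u v).trans (hu.add hv)⟩
  smul_mem' := by
    rintro c u ⟨f, hf, hu⟩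
    exact ⟨c • f, hf.const_smul c, (Lp.coeFn_smul c u).trans (hu.const_smul c)⟩

/-- The space `H¹_r(𝔹^N)` of radial functions in `H¹(𝔹^N)`. A separate type, because it carries
the Dirichlet norm below and not the norm of `L²`. -/
def H1r (N : ℕ) : Type := ↥(H1 N ⊓ radial N)

namespace H1r

instance (N : ℕ) : AddCommGroup (H1r N) := inferInstanceAs (AddCommGroup ↥(H1 N ⊓ radial N))

instance (N : ℕ) : Module ℝ (H1r N) := inferInstanceAs (Module ℝ ↥(H1 N ⊓ radial N))

/-- The element of `L²(𝔹^N, dV)` underlying `u ∈ H¹_r(𝔹^N)`. -/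
def toL2 {N : ℕ} (u : H1r N) : Lp ℝ 2 (hypVol N) := Subtype.val u

/-- The hyperbolic gradient on `H¹_r(𝔹^N)`. -/
def grad (N : ℕ) : H1r N →ₗ[ℝ] Lp (Eu N) 2 (hypVol N) :=
  (hypGrad N).comp (Submodule.inclusion (inf_le_left : H1 N ⊓ radial N ≤ H1 N))

/-- `H¹_r(𝔹^N)` is normed by `‖u‖² = ∫ |∇_𝔹 u|² dV`. -/
instance (N : ℕ) : SeminormedAddCommGroup (H1r N) :=
  SeminormedAddCommGroup.induced (H1r N) (Lp (Eu N) 2 (hypVol N)) (grad N)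

instance (N : ℕ) : NormedSpace ℝ (H1r N) :=
  NormedSpace.induced ℝ (H1r N) (Lp (Eu N) 2 (hypVol N)) (grad N)

theorem norm_sq_eq {N : ℕ} (u : H1r N) :
    ‖u‖ ^ 2 = ∫ x, ‖grad N u x‖ ^ 2 ∂(hypVol N) := by
  have h : ‖u‖ = ‖grad N u‖ := rfl
  rw [h, ← real_inner_self_eq_norm_sq, L2.inner_def]
  simp only [real_inner_self_eq_norm_sq]

end H1r

/-- `H = H¹_r(𝔹^N) × H¹_r(𝔹^N)` with `‖(u,v)‖² = ‖u‖² + ‖v‖²`. -/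
abbrev HSpace (N : ℕ) : Type := WithLp 2 (H1r N × H1r N)

/-- `L^p(𝔹^N) × L^p(𝔹^N)` with `‖(u,v)‖^p = ‖u‖_p^p + ‖v‖_p^p`. -/
abbrev LpPair (N : ℕ) (p : ℝ≥0∞) : Type := WithLp p (Lp ℝ p (hypVol N) × Lp ℝ p (hypVol N))

/-- The critical exponent: `2N / (N - 2 - 2m)` if `m < (N - 2) / 2`, and `∞` otherwise. -/
def critExp (N : ℕ) (m : ℝ) : EReal :=
  if m < ((N : ℝ) - 2) / 2 then ((2 * (N : ℝ) / ((N : ℝ) - 2 - 2 * m) : ℝ) : EReal) else ⊤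

end Hyperbolic

end

/-!
A radial function on the Poincaré ball is recovered from its hyperbolic gradient by integrating
inwards from the ideal boundary, and this makes the weighted embedding an integral operator with a
kernel in a Bochner space, which is automatically compact.

Write `τ = 1 / ρ` and let `ω` be the area of the unit sphere. For `u ∈ H¹_r` with hyperbolic
gradient `g = ∇_𝔹 u`, testing the weak gradient against the fields `ψ(|x|) x / |x|^N`, whose
divergence is `ψ'(|x|) / |x|^{N-1}`, turns the definition of the weak gradient into a statement on
`(0, 1)` (`HasWeakGradient.integral_deriv`). By Fubini (`integral_mul_tail`) and the
du Bois-Reymond lemma (`ae_const_of_weak_deriv_zero`), `u(x)` equals `⟪k_{|x|}, g⟫` in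
`L²(𝔹^N, dV)` up to an additive constant, where `k_r(y) = -τ^{N-1} y / (ω |y|^N)` for `|y| > r` and
`k_r(y) = 0` otherwise. Since `u` is square-integrable, `‖k_r‖ → 0` as `r → 1` and the volume near
the boundary is infinite, the constant is zero (`toL2_ae_eq`).

Hence `d^m u = ⟪κ(·), g⟫` with `κ(x) = d(x)^m k_{|x|}`. For any `κ ∈ L^p(μ; E)` with `E` a real
inner product space and `1 ≤ p < ∞`, the operator `g ↦ ⟪κ(·), g⟫` from `E` to `L^p(μ)` is compact,
being a norm limit of finite-rank operators (`isCompactOperator_kernelOp`). It remains to see that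
`κ ∈ L^p` (`memLp_kernel`): the bound `‖k_r‖² ≤ C r^{2-N} (1 - r)^{N-1}` (`norm_radKer_sq_le`) leads
to a Beta integral, which converges at the origin exactly when `p` is subcritical and at the
boundary because `p > 2`.
-/

noncomputable section

namespace Hyperbolic

/-! ### Compactness of operators given by Bochner kernels -/

section Kernel

variable {X E : Type*} [MeasurableSpace X] {μ : Measure X} [NormedAddCommGroup E]
  [InnerProductSpace ℝ E] {p : ℝ≥0∞} [Fact (1 ≤ p)]

variable (E μ p) in
/-- The operator `g ↦ (x ↦ ⟪g, κ x⟫)` from `E` to `L^p(μ)` attached to a kernel `κ ∈ L^p(μ; E)`,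
as a continuous linear function of `κ`. -/
def kernelOp : Lp E p μ →L[ℝ] E →L[ℝ] Lp ℝ p μ :=
  (ContinuousLinearMap.compLpL₂ p μ (innerSL ℝ : E →L[ℝ] E →L[ℝ] ℝ)).flip

theorem kernelOp_apply_ae (κ : Lp E p μ) (g : E) :
    kernelOp E μ p κ g =ᵐ[μ] fun x => inner ℝ g (κ x) :=
  ContinuousLinearMap.coeFn_compLp (innerSL ℝ g) κ

/-- Indicator kernels give operators of rank at most one, sums of such kernels are dense, and the
compact operators are closed in the operator norm. -/
theorem isCompactOperator_kernelOp (hp : p ≠ ⊤) (κ : Lp E p μ) :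
    IsCompactOperator (kernelOp E μ p κ) := by
  induction κ using Lp.induction hp with
  | @indicatorConst c s hs hμs =>
    have h : kernelOp E μ p (Lp.simpleFunc.indicatorConst p hs hμs.ne c) =
        (ContinuousLinearMap.toSpanSingleton ℝ (indicatorConstLp p hs hμs.ne (1 : ℝ))).comp
          (innerSL ℝ c) := by
      ext1 g
      apply Lp.ext
      refine (kernelOp_apply_ae _ g).trans ?_
      rw [Lp.simpleFunc.coe_indicatorConst]
      have e : (ContinuousLinearMap.toSpanSingleton ℝ (indicatorConstLp p hs hμs.ne (1 : ℝ))).comp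
          (innerSL ℝ c) g = inner ℝ c g • indicatorConstLp p hs hμs.ne (1 : ℝ) := by simp
      rw [e]
      filter_upwards [indicatorConstLp_coeFn (p := p) (hs := hs) (hμs := hμs.ne) (c := c),
        indicatorConstLp_coeFn (p := p) (hs := hs) (hμs := hμs.ne) (c := (1 : ℝ)),
        Lp.coeFn_smul (inner ℝ c g) (indicatorConstLp p hs hμs.ne (1 : ℝ))] with x h1 h2 h3
      rw [h1, h3, Pi.smul_apply, h2]
      by_cases hx : x ∈ s <;> simp [hx, real_inner_comm]
    rw [h]
    exact (isCompactOperator_of_locallyCompactSpace_rng (ContinuousLinearMap.toSpanSingleton ℝ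
      (indicatorConstLp p hs hμs.ne (1 : ℝ)))).comp_clm (innerSL ℝ c)
  | add hf hg _ h1 h2 =>
    rw [map_add]
    exact h1.add h2
  | isClosed => exact isClosed_setOfPred_isCompactOperator.preimage (kernelOp E μ p).continuous

end Kernel

/-! ### Radial functions and polar coordinates -/

/-- The area `N |𝔹^N|` of the Euclidean unit sphere of `ℝ^N`. -/
def sphereArea (N : ℕ) : ℝ := N * (volume : Measure (Eu N)).real (unitBall N)

/-- `1 / ρ = (1 - r²) / 2` as a function of `r = |x|`. -/
def invConf (r : ℝ) : ℝ := (1 - r ^ 2) / 2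

theorem inv_conf {N : ℕ} (x : Eu N) : (conf x)⁻¹ = invConf ‖x‖ := by
  simp [conf, invConf]

theorem conf_eq {N : ℕ} (x : Eu N) : conf x = (invConf ‖x‖)⁻¹ := by
  rw [← inv_conf, inv_inv]

theorem invConf_pos {r : ℝ} (h0 : 0 ≤ r) (h1 : r < 1) : 0 < invConf r := by
  unfold invConf; nlinarith

theorem invConf_le (r : ℝ) : invConf r ≤ 1 - r := by
  unfold invConf; nlinarith [sq_nonneg (1 - r)]

theorem le_invConf {r : ℝ} (h0 : 0 ≤ r) (h1 : r ≤ 1) : (1 - r) / 2 ≤ invConf r := by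
  unfold invConf; nlinarith

theorem sphereArea_pos {N : ℕ} [NeZero N] : 0 < sphereArea N := by
  unfold sphereArea
  have h : 0 < (volume : Measure (Eu N)).real (unitBall N) :=
    ENNReal.toReal_pos (measure_ball_pos volume 0 one_pos).ne' measure_ball_lt_top.ne
  have h0 : (0 : ℝ) < N := by exact_mod_cast Nat.pos_of_neZero N
  positivity

theorem measurable_conf_pow (N : ℕ) : Measurable fun x : Eu N => ENNReal.ofReal (conf x ^ N) := by
  have : Measurable fun x : Eu N => conf x ^ N := by unfold conf; fun_prop
  exact this.ennreal_ofReal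

section Integrals

variable {N : ℕ} {F : Type*} [NormedAddCommGroup F] [NormedSpace ℝ F]

theorem ae_ofReal_conf_pow : ∀ᵐ x ∂(volume.restrict (unitBall N)),
    (ENNReal.ofReal (conf x ^ N)).toReal = (invConf ‖x‖ ^ N)⁻¹ := by
  filter_upwards [ae_restrict_mem measurableSet_ball] with x hx
  rw [ENNReal.toReal_ofReal (pow_nonneg (conf_pos hx).le N), conf_eq, inv_pow]

theorem integral_hypVol (f : Eu N → F) :
    ∫ x, f x ∂(hypVol N) = ∫ x in unitBall N, (invConf ‖x‖ ^ N)⁻¹ • f x := by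
  rw [hypVol, integral_withDensity_eq_integral_toReal_smul (measurable_conf_pow N) (by simp)]
  refine integral_congr_ae ?_
  filter_upwards [ae_ofReal_conf_pow] with x hx
  rw [hx]

theorem integrable_hypVol_iff {f : Eu N → F} :
    Integrable f (hypVol N) ↔ IntegrableOn (fun x => (invConf ‖x‖ ^ N)⁻¹ • f x) (unitBall N) := by
  rw [hypVol, integrable_withDensity_iff_integrable_smul' (measurable_conf_pow N) (by simp)]
  refine integrable_congr ?_
  filter_upwards [ae_ofReal_conf_pow] with x hx
  rw [hx]

theorem ae_hypVol_mem_ball : ∀ᵐ x ∂(hypVol N), x ∈ unitBall N :=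
  (hypVol_ac N).ae_le (ae_restrict_mem measurableSet_ball)

theorem ae_hypVol_iff {P : Eu N → Prop} :
    (∀ᵐ x ∂(hypVol N), P x) ↔ ∀ᵐ x ∂(volume.restrict (unitBall N)), P x :=
  ⟨fun h => (ac_hypVol N).ae_le h, fun h => (hypVol_ac N).ae_le h⟩

variable [NeZero N]

theorem setIntegral_ball_radial (f : ℝ → ℝ) :
    ∫ x in unitBall N, f ‖x‖ = sphereArea N * ∫ r in Ioo 0 1, r ^ (N - 1) * f r := by
  have h : ∀ x : Eu N, (unitBall N).indicator (fun x => f ‖x‖) x = (Iio 1).indicator f ‖x‖ := by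
    intro x
    by_cases hx : ‖x‖ < 1 <;> simp [indicator, hx]
  rw [← integral_indicator measurableSet_ball, funext h,
    integral_fun_norm_addHaar volume ((Iio 1).indicator f), finrank_euclideanSpace_fin,
    nsmul_eq_mul, smul_eq_mul, sphereArea, mul_assoc]
  congr 2
  rw [← Ioi_inter_Iio, ← setIntegral_indicator measurableSet_Iio]
  congr 1
  ext r
  by_cases hr : r < 1 <;> simp [hr]

theorem integrableOn_ball_radial {f : ℝ → ℝ} :
    IntegrableOn (fun x : Eu N => f ‖x‖) (unitBall N) ↔
      IntegrableOn (fun r => r ^ (N - 1) * f r) (Ioo 0 1) := by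
  have := integrableOn_fun_norm_addHaar (volume : Measure (Eu N)) (f := f) (r := 1)
  simpa [finrank_euclideanSpace_fin] using this

theorem integral_hypVol_radial (f : ℝ → ℝ) :
    ∫ x, f ‖x‖ ∂(hypVol N) =
      sphereArea N * ∫ r in Ioo 0 1, r ^ (N - 1) * ((invConf r ^ N)⁻¹ * f r) := by
  rw [integral_hypVol]
  exact setIntegral_ball_radial fun r => (invConf r ^ N)⁻¹ * f r

theorem integrable_hypVol_radial {f : ℝ → ℝ} :
    Integrable (fun x : Eu N => f ‖x‖) (hypVol N) ↔
      IntegrableOn (fun r => r ^ (N - 1) * ((invConf r ^ N)⁻¹ * f r)) (Ioo 0 1) := by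
  rw [integrable_hypVol_iff]
  exact integrableOn_ball_radial (f := fun r => (invConf r ^ N)⁻¹ * f r)

/-- The preimage of a null set of radii is null. -/
theorem ae_norm_of_ae {P : ℝ → Prop} (h : ∀ᵐ r ∂(volume.restrict (Ioo 0 1)), P r) :
    ∀ᵐ x ∂(hypVol N), P ‖x‖ := by
  set A := toMeasurable (volume.restrict (Ioo (0 : ℝ) 1)) {r | ¬ P r} with hA
  have hA0 : volume.restrict (Ioo (0 : ℝ) 1) A = 0 := by
    rw [hA, measure_toMeasurable]; exact h
  have hAm : MeasurableSet A := measurableSet_toMeasurable _ _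
  have hz : (fun r : ℝ => r ^ (N - 1) * A.indicator (fun _ => (1 : ℝ)) r)
      =ᵐ[volume.restrict (Ioo 0 1)] 0 := by
    filter_upwards [measure_eq_zero_iff_ae_notMem.1 hA0] with r hr
    simp [hr]
  have hi : IntegrableOn (fun x : Eu N => A.indicator (fun _ => (1 : ℝ)) ‖x‖) (unitBall N) :=
    integrableOn_ball_radial.2 ((integrable_zero _ _ _).congr hz.symm)
  have h0 : ∫ x in unitBall N, A.indicator (fun _ => (1 : ℝ)) ‖x‖ = 0 := by
    rw [setIntegral_ball_radial, integral_congr_ae hz]; simp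
  rw [integral_eq_zero_iff_of_nonneg
    (fun x => indicator_nonneg (fun _ _ => zero_le_one) _) hi] at h0
  rw [ae_hypVol_iff]
  filter_upwards [h0] with x hx
  by_contra hP
  have : ‖x‖ ∈ A := subset_toMeasurable _ _ hP
  simp [this] at hx

end Integrals

/-! ### The representing kernel -/

/-- The radial profile of the representing kernel: `-ρ^{1-N} / (ω r^N)` with `r = |y|` and `ω` the
area of the unit sphere. -/
def kerCoef (N : ℕ) (r : ℝ) : ℝ := -((sphereArea N * r ^ N)⁻¹ * invConf r ^ (N - 1))

/-- The vector field `y ↦ -ρ^{1-N} y / (ω |y|^N)`, restricted to `|y| ∈ J`. -/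
def kerFun (N : ℕ) (J : Set ℝ) (y : Eu N) : Eu N := J.indicator (kerCoef N) ‖y‖ • y

/-- The kernel `k_r` with `u(x) = ⟪k_{|x|}, ∇_𝔹 u⟫` for radial `u`: the field `kerFun` outside the
ball of radius `r`, as an element of `L²(𝔹^N, dV)`. The value is `0` where the field is not
square-integrable. -/
def radKer (N : ℕ) (r : ℝ) : Lp (Eu N) 2 (hypVol N) :=
  open Classical in
  if h : MemLp (kerFun N (Ioi r)) 2 (hypVol N) then h.toLp else 0

variable {N : ℕ}

theorem measurable_kerCoef : Measurable (kerCoef N) := by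
  unfold kerCoef invConf; fun_prop

theorem measurable_kerFun {J : Set ℝ} (hJ : MeasurableSet J) : Measurable (kerFun N J) :=
  ((measurable_kerCoef.indicator hJ).comp measurable_norm).smul measurable_id

theorem norm_sq_kerFun (J : Set ℝ) (y : Eu N) :
    ‖kerFun N J y‖ ^ 2 = J.indicator (fun r => kerCoef N r ^ 2 * r ^ 2) ‖y‖ := by
  rw [kerFun, norm_smul, mul_pow, Real.norm_eq_abs, sq_abs]
  by_cases h : ‖y‖ ∈ J <;> simp [h]

/-- The square of the kernel times the volume density in polar coordinates. -/
theorem radial_density_kerCoef [NeZero N] (hN : 2 ≤ N) {r : ℝ} (hr : r ∈ Ioo (0 : ℝ) 1) :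
    r ^ (N - 1) * ((invConf r ^ N)⁻¹ * (kerCoef N r ^ 2 * r ^ 2)) =
      ((sphereArea N) ^ 2)⁻¹ * ((r ^ (N - 1))⁻¹ * invConf r ^ (N - 2)) := by
  have h1 := (invConf_pos hr.1.le hr.2).ne'
  have h2 := (sphereArea_pos (N := N)).ne'
  have h3 := hr.1.ne'
  unfold kerCoef
  generalize sphereArea N = w at *
  generalize invConf r = t at *
  obtain ⟨n, rfl⟩ := Nat.exists_eq_add_of_le' hN
  simp only [Nat.add_sub_cancel, show n + 2 - 1 = n + 1 by omega]
  field_simp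
  ring

theorem radial_density_indicator [NeZero N] (hN : 2 ≤ N) (J : Set ℝ) {r : ℝ}
    (hr : r ∈ Ioo (0 : ℝ) 1) :
    r ^ (N - 1) * ((invConf r ^ N)⁻¹ * J.indicator (fun r => kerCoef N r ^ 2 * r ^ 2) r) =
      J.indicator
        (fun r => ((sphereArea N) ^ 2)⁻¹ * ((r ^ (N - 1))⁻¹ * invConf r ^ (N - 2))) r := by
  by_cases h : r ∈ J
  · simp only [indicator_of_mem h, radial_density_kerCoef hN hr]
  · simp [h]

theorem density_le {a r : ℝ} (ha : 0 < a) (har : a ≤ r) (hr : r < 1) :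
    (r ^ (N - 1))⁻¹ * invConf r ^ (N - 2) ≤ (a ^ (N - 1))⁻¹ := by
  have h0 := invConf_pos (ha.le.trans har) hr
  have h1 : invConf r ≤ 1 := (invConf_le r).trans (by linarith)
  calc (r ^ (N - 1))⁻¹ * invConf r ^ (N - 2) ≤ (a ^ (N - 1))⁻¹ * 1 := by
        gcongr
        exact pow_le_one₀ h0.le h1
    _ = _ := mul_one _

theorem integrableOn_density {a : ℝ} (ha : 0 < a) :
    IntegrableOn (fun r => (r ^ (N - 1))⁻¹ * invConf r ^ (N - 2)) (Ioo 0 1 ∩ Ioi a) := by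
  refine Measure.integrableOn_of_bounded (M := (a ^ (N - 1))⁻¹) ?_ ?_ ?_
  · exact ((measure_mono inter_subset_left).trans_lt measure_Ioo_lt_top).ne
  · unfold invConf
    exact Measurable.aestronglyMeasurable (by fun_prop)
  · refine (ae_restrict_mem (measurableSet_Ioo.inter measurableSet_Ioi)).mono fun r hr => ?_
    have h0 := invConf_pos hr.1.1.le hr.1.2
    have h1 := hr.1.1
    rw [Real.norm_of_nonneg (by positivity)]
    exact density_le ha (le_of_lt hr.2) hr.1.2

theorem memLp_kerFun [NeZero N] (hN : 2 ≤ N) {a : ℝ} (ha : 0 < a) {J : Set ℝ}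
    (hJ : MeasurableSet J) (haJ : J ⊆ Ioi a) : MemLp (kerFun N J) 2 (hypVol N) := by
  rw [memLp_two_iff_integrable_sq_norm (measurable_kerFun hJ).aestronglyMeasurable]
  simp only [norm_sq_kerFun]
  refine (integrable_hypVol_radial (N := N)
    (f := J.indicator fun r => kerCoef N r ^ 2 * r ^ 2)).2 ?_
  refine (integrableOn_congr_fun (fun r hr => radial_density_indicator hN J hr)
    measurableSet_Ioo).2 ?_
  rw [IntegrableOn, integrable_indicator_iff hJ, IntegrableOn, Measure.restrict_restrict hJ,
    inter_comm]
  exact ((integrableOn_density ha).mono_set (inter_subset_inter_right _ haJ)).const_mul _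

theorem norm_sq_toLp_kerFun [NeZero N] (hN : 2 ≤ N) {J : Set ℝ} (hJ : MeasurableSet J)
    (h : MemLp (kerFun N J) 2 (hypVol N)) :
    ‖h.toLp‖ ^ 2 =
      (sphereArea N)⁻¹ * ∫ r in Ioo 0 1 ∩ J, (r ^ (N - 1))⁻¹ * invConf r ^ (N - 2) := by
  have e : ‖h.toLp‖ ^ 2 = ∫ y, ‖kerFun N J y‖ ^ 2 ∂(hypVol N) := by
    rw [← real_inner_self_eq_norm_sq, L2.inner_def]
    refine integral_congr_ae (h.coeFn_toLp.mono fun x hx => ?_)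
    simp only [hx, real_inner_self_eq_norm_sq]
  rw [e]
  simp only [norm_sq_kerFun]
  rw [integral_hypVol_radial (J.indicator fun r => kerCoef N r ^ 2 * r ^ 2),
    setIntegral_congr_fun measurableSet_Ioo (fun r hr => radial_density_indicator hN J hr),
    setIntegral_indicator hJ, integral_const_mul, ← mul_assoc]
  congr 1
  have := (sphereArea_pos (N := N)).ne'
  field_simp

theorem radKer_eq [NeZero N] (hN : 2 ≤ N) {r : ℝ} (hr : 0 < r) :
    radKer N r = (memLp_kerFun hN hr measurableSet_Ioi subset_rfl).toLp :=
  dif_pos _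

theorem norm_radKer_sub_sq_le [NeZero N] (hN : 2 ≤ N) {a r s : ℝ} (ha : 0 < a) (har : a ≤ r)
    (hrs : r ≤ s) :
    ‖radKer N r - radKer N s‖ ^ 2 ≤ (sphereArea N)⁻¹ * ((a ^ (N - 1))⁻¹ * (s - r)) := by
  have hr := ha.trans_le har
  have hm := memLp_kerFun (N := N) hN hr measurableSet_Ioc (fun x (hx : x ∈ Ioc r s) => hx.1)
  have e : radKer N r - radKer N s = hm.toLp := by
    rw [radKer_eq hN hr, radKer_eq hN (hr.trans_le hrs), ← MemLp.toLp_sub]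
    refine MemLp.toLp_congr _ _ (Filter.Eventually.of_forall fun y => ?_)
    simp only [Pi.sub_apply, kerFun, ← sub_smul]
    congr 1
    simp only [indicator, mem_Ioi, mem_Ioc]
    grind
  rw [e, norm_sq_toLp_kerFun hN measurableSet_Ioc]
  have hw := sphereArea_pos (N := N)
  gcongr
  have hsub : Ioo (0 : ℝ) 1 ∩ Ioc r s ⊆ Ioc r s := inter_subset_right
  have hfin : volume (Ioo (0 : ℝ) 1 ∩ Ioc r s) < ⊤ :=
    (measure_mono hsub).trans_lt measure_Ioc_lt_top
  calc ∫ t in Ioo 0 1 ∩ Ioc r s, (t ^ (N - 1))⁻¹ * invConf t ^ (N - 2)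
      ≤ ∫ t in Ioo 0 1 ∩ Ioc r s, (a ^ (N - 1))⁻¹ := by
        refine setIntegral_mono_on ((integrableOn_density hr).mono_set
          (inter_subset_inter_right _ fun x hx => hx.1)) (integrableOn_const hfin.ne)
          (measurableSet_Ioo.inter measurableSet_Ioc) fun t ht => ?_
        exact density_le ha (har.trans ht.2.1.le) ht.1.2
    _ = volume.real (Ioo 0 1 ∩ Ioc r s) * (a ^ (N - 1))⁻¹ := by
        rw [setIntegral_const, smul_eq_mul]
    _ ≤ (s - r) * (a ^ (N - 1))⁻¹ := by
        gcongr
        calc volume.real (Ioo 0 1 ∩ Ioc r s) ≤ volume.real (Ioc r s) :=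
              measureReal_mono hsub measure_Ioc_lt_top.ne
          _ = s - r := Real.volume_real_Ioc_of_le hrs
    _ = _ := mul_comm _ _

theorem continuousOn_radKer [NeZero N] (hN : 2 ≤ N) : ContinuousOn (radKer N) (Ioi 0) := by
  intro r hr
  have hr : 0 < r := hr
  set C := (sphereArea N)⁻¹ * ((r / 2) ^ (N - 1))⁻¹
  refine ContinuousAt.continuousWithinAt ?_
  rw [ContinuousAt, tendsto_iff_norm_sub_tendsto_zero]
  have hlim : Filter.Tendsto (fun s => √(C * |s - r|)) (nhds r) (nhds 0) := by
    have : Continuous fun s => √(C * |s - r|) := by fun_prop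
    simpa using this.tendsto r
  refine squeeze_zero' (Filter.Eventually.of_forall fun s => norm_nonneg _) ?_ hlim
  filter_upwards [lt_mem_nhds (show r / 2 < r by linarith)] with s hs
  apply Real.le_sqrt_of_sq_le
  rcases le_total s r with h | h
  · rw [abs_of_nonpos (by linarith)]
    have := norm_radKer_sub_sq_le (N := N) hN (half_pos hr) hs.le h
    convert this using 1
    ring
  · rw [abs_of_nonneg (by linarith), norm_sub_rev]
    have := norm_radKer_sub_sq_le (N := N) hN (half_pos hr) (by linarith) h
    convert this using 1
    ring

theorem setIntegral_inv_sq {r : ℝ} (h0 : 0 < r) (h1 : r < 1) :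
    IntegrableOn (fun t : ℝ => (t ^ 2)⁻¹) (Ioc r 1) ∧ ∫ t in Ioc r 1, (t ^ 2)⁻¹ = (1 - r) / r := by
  have hz : (0 : ℝ) ∉ uIcc r 1 := by
    rw [uIcc_of_le h1.le]; exact fun h => absurd h.1 (not_le.2 h0)
  have hi : IntervalIntegrable (fun t : ℝ => t ^ (-2 : ℤ)) volume r 1 :=
    intervalIntegral.intervalIntegrable_zpow (Or.inr hz)
  have he := integral_zpow (a := r) (b := 1) (n := -2) (Or.inr ⟨by norm_num, hz⟩)
  have hf : (fun t : ℝ => t ^ (-2 : ℤ)) = fun t => (t ^ 2)⁻¹ := by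
    ext t; rw [zpow_neg]; norm_cast
  rw [hf] at hi he
  refine ⟨(intervalIntegrable_iff_integrableOn_Ioc_of_le h1.le).1 hi, ?_⟩
  rw [← intervalIntegral.integral_of_le h1.le, he]
  norm_num
  field_simp
  ring

/-- Decay of the kernel: like `d(x)^{-(N-2)/2}` near the origin and like `ρ^{-(N-1)/2}` at
infinity. -/
theorem norm_radKer_sq_le [NeZero N] (hN : 3 ≤ N) {r : ℝ} (hr : 0 < r) (hr1 : r < 1) :
    ‖radKer N r‖ ^ 2 ≤ (sphereArea N)⁻¹ * ((r ^ (N - 2))⁻¹ * (1 - r) ^ (N - 1)) := by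
  rw [radKer_eq (by omega) hr, norm_sq_toLp_kerFun (by omega) measurableSet_Ioi]
  have hw := sphereArea_pos (N := N)
  gcongr
  have hsub : Ioo (0 : ℝ) 1 ∩ Ioi r ⊆ Ioc r 1 := fun t ht => ⟨ht.2, ht.1.2.le⟩
  obtain ⟨hi, he⟩ := setIntegral_inv_sq hr hr1
  obtain ⟨n, rfl⟩ := Nat.exists_eq_add_of_le' hN
  simp only [show n + 3 - 1 = n + 2 by omega, show n + 3 - 2 = n + 1 by omega]
  have h1r : 0 < 1 - r := by linarith
  have hi' : IntegrableOn (fun t : ℝ => (r ^ n)⁻¹ * (1 - r) ^ (n + 1) * (t ^ 2)⁻¹) (Ioc r 1) :=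
    hi.const_mul ((r ^ n)⁻¹ * (1 - r) ^ (n + 1))
  calc ∫ t in Ioo 0 1 ∩ Ioi r, (t ^ (n + 2))⁻¹ * invConf t ^ (n + 1)
      ≤ ∫ t in Ioo 0 1 ∩ Ioi r, (r ^ n)⁻¹ * (1 - r) ^ (n + 1) * (t ^ 2)⁻¹ := by
        refine setIntegral_mono_on (integrableOn_density (N := n + 3) hr) (hi'.mono_set hsub)
          (measurableSet_Ioo.inter measurableSet_Ioi) fun t ht => ?_
        have ht0 := ht.1.1
        have hrt : r < t := ht.2
        have h2 : invConf t ≤ 1 - r := (invConf_le t).trans (by linarith)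
        have h3 := invConf_pos ht0.le ht.1.2
        calc (t ^ (n + 2))⁻¹ * invConf t ^ (n + 1)
            = (t ^ n)⁻¹ * invConf t ^ (n + 1) * (t ^ 2)⁻¹ := by
              rw [pow_add, mul_inv]; ring
          _ ≤ (r ^ n)⁻¹ * (1 - r) ^ (n + 1) * (t ^ 2)⁻¹ := by gcongr
    _ ≤ ∫ t in Ioc r 1, (r ^ n)⁻¹ * (1 - r) ^ (n + 1) * (t ^ 2)⁻¹ := by
        refine setIntegral_mono_set hi' ?_ hsub.eventuallyLE
        refine Filter.Eventually.of_forall fun t => ?_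
        simp only [Pi.zero_apply]
        positivity
    _ = (r ^ (n + 1))⁻¹ * (1 - r) ^ (n + 2) := by
        rw [integral_const_mul, he]
        field_simp
        ring

/-- The value at radius `r` of the radial function with hyperbolic gradient `g`. -/
theorem inner_radKer [NeZero N] (hN : 2 ≤ N) {r : ℝ} (hr : 0 < r) (g : Lp (Eu N) 2 (hypVol N)) :
    IntegrableOn (fun y => kerCoef N ‖y‖ * inner ℝ y (g y)) {y | r < ‖y‖} (hypVol N) ∧
    inner ℝ (radKer N r) g =
      ∫ y in {y | r < ‖y‖}, kerCoef N ‖y‖ * inner ℝ y (g y) ∂(hypVol N) := by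
  have hms : MeasurableSet {y : Eu N | r < ‖y‖} := measurableSet_lt measurable_const measurable_norm
  have h := memLp_kerFun (N := N) hN hr measurableSet_Ioi subset_rfl
  have hae : (fun y => inner ℝ (radKer N r y) (g y)) =ᵐ[hypVol N]
      {y | r < ‖y‖}.indicator fun y => kerCoef N ‖y‖ * inner ℝ y (g y) := by
    rw [radKer_eq hN hr]
    filter_upwards [h.coeFn_toLp] with y hy
    rw [hy, kerFun, real_inner_smul_left]
    by_cases hy : r < ‖y‖ <;> simp [hy]
  constructor
  · rw [← integrable_indicator_iff hms]
    exact (L2.integrable_inner (𝕜 := ℝ) _ _).congr hae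
  · rw [L2.inner_def, integral_congr_ae hae, integral_indicator hms]

/-! ### Primitives of test functions on the unit interval -/

/-- A test function on `(0, 1)` with integral zero is the derivative of a test function. -/
theorem exists_primitive {η : ℝ → ℝ} (hη : ContDiff ℝ ∞ η) (hc : HasCompactSupport η)
    (hs : tsupport η ⊆ Ioo 0 1) (h0 : ∫ t, η t = 0) :
    ∃ ψ : ℝ → ℝ, ContDiff ℝ ∞ ψ ∧ HasCompactSupport ψ ∧ tsupport ψ ⊆ Ioo 0 1 ∧ deriv ψ = η ∧
      ∀ s, ∫ t in Iio s, η t = ψ s := by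
  -- the support sits in a closed interval `[a, b]` inside `(0, 1)`
  obtain ⟨a, b, ha, hb, hab⟩ : ∃ a b : ℝ, 0 < a ∧ b < 1 ∧ tsupport η ⊆ Icc a b := by
    rcases (tsupport η).eq_empty_or_nonempty with h | h
    · exact ⟨1, 0, one_pos, zero_lt_one, by simp [h]⟩
    · have hc' : IsCompact (tsupport η) := hc
      obtain ⟨a, ha, ha'⟩ := hc'.exists_isLeast h
      obtain ⟨b, hb, hb'⟩ := hc'.exists_isGreatest h
      exact ⟨a, b, (hs ha).1, (hs hb).2, fun x hx => ⟨ha' hx, hb' hx⟩⟩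
  have hz : ∀ t, t ∉ Icc a b → η t = 0 := fun t ht =>
    image_eq_zero_of_notMem_tsupport fun h => ht (hab h)
  have hi : Integrable η := hη.continuous.integrable_of_hasCompactSupport hc
  set ψ : ℝ → ℝ := fun s => ∫ t in Iio s, η t with hψ
  have hd : ∀ s, HasDerivAt ψ (η s) s := by
    intro s
    have e : ψ = fun s => (∫ t in Iic (0 : ℝ), η t) + ∫ t in (0 : ℝ)..s, η t := by
      ext s
      have h1 : ψ s = ∫ t in Iic s, η t := integral_Iic_eq_integral_Iio.symm
      rw [h1, ← intervalIntegral.integral_Iic_sub_Iic hi.integrableOn hi.integrableOn]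
      ring
    rw [e]
    exact (intervalIntegral.integral_hasDerivAt_right (hi.intervalIntegrable)
      hη.continuous.stronglyMeasurable.stronglyMeasurableAtFilter
      hη.continuous.continuousAt).const_add _
  have hderiv : deriv ψ = η := funext fun s => (hd s).deriv
  have hsub : tsupport ψ ⊆ Icc a b := by
    refine closure_minimal (fun s hs => ?_) isClosed_Icc
    by_contra h
    refine hs ?_
    rcases lt_or_ge s a with h1 | h1
    · refine setIntegral_eq_zero_of_forall_eq_zero fun t ht => hz t fun h2 => ?_
      exact absurd (h2.1.trans_lt ht) (not_lt.2 h1.le)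
    · have h2 : b < s := by
        by_contra h2
        exact h ⟨h1, not_lt.1 h2⟩
      rw [← h0]
      refine setIntegral_eq_integral_of_forall_compl_eq_zero fun t ht => hz t fun h3 => ?_
      exact ht (h3.2.trans_lt h2)
  refine ⟨ψ, ?_, HasCompactSupport.of_support_subset_isCompact isCompact_Icc
    ((subset_tsupport ψ).trans hsub),
    fun t ht => ⟨ha.trans_le (hsub ht).1, (hsub ht).2.trans_lt hb⟩,
    hderiv, fun s => rfl⟩
  rw [contDiff_infty_iff_deriv]
  exact ⟨fun s => (hd s).differentiableAt, hderiv ▸ hη⟩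

/-- The du Bois-Reymond lemma: a function on `(0, 1)` with vanishing weak derivative is constant. -/
theorem ae_const_of_weak_deriv_zero {f : ℝ → ℝ} (hf : LocallyIntegrableOn f (Ioo 0 1))
    (h : ∀ ψ : ℝ → ℝ, ContDiff ℝ ∞ ψ → HasCompactSupport ψ → tsupport ψ ⊆ Ioo 0 1 →
      (∀ s, ∫ t in Iio s, deriv ψ t = ψ s) → ∫ t, f t * deriv ψ t = 0) :
    ∃ c : ℝ, ∀ᵐ r ∂(volume.restrict (Ioo (0 : ℝ) 1)), f r = c := by
  -- a normalised bump; every test function differs from a multiple of it by a derivative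
  let B : ContDiffBump (1 / 2 : ℝ) := ⟨1 / 8, 1 / 4, by norm_num, by norm_num⟩
  set η₀ := B.normed volume with hη₀
  have hη₀s : ContDiff ℝ ∞ η₀ := B.contDiff_normed
  have hη₀c : HasCompactSupport η₀ := B.hasCompactSupport_normed
  have hη₀t : tsupport η₀ ⊆ Ioo 0 1 := by
    rw [hη₀, B.tsupport_normed_eq, Real.closedBall_eq_Icc]
    intro x hx
    have h1 := hx.1
    have h2 := hx.2
    simp only [B] at h1 h2
    constructor <;> linarith
  have hη₀i : ∫ t, η₀ t = 1 := B.integral_normed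
  have hint : ∀ η : ℝ → ℝ, ContDiff ℝ ∞ η → HasCompactSupport η → tsupport η ⊆ Ioo 0 1 →
      Integrable fun t => η t * f t := by
    intro η h1 h2 h3
    have h4 : IntegrableOn f (tsupport η) := hf.integrableOn_compact_subset h3 h2
    refine (integrableOn_iff_integrable_of_support_subset ?_).1
      (h4.continuousOn_mul h1.continuous.continuousOn h2)
    exact (Function.support_mul_subset_left η f).trans (subset_tsupport η)
  set c := ∫ t, η₀ t * f t with hc
  refine ⟨c, ?_⟩
  have key : ∀ᵐ x ∂(volume : Measure ℝ), x ∈ Ioo (0 : ℝ) 1 → f x - c = 0 := by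
    refine isOpen_Ioo.ae_eq_zero_of_integral_contDiff_smul_eq_zero
      (hf.sub (locallyIntegrableOn_const c)) fun η h1 h2 h3 => ?_
    set I := ∫ t, η t with hI
    have i1 : Integrable η := h1.continuous.integrable_of_hasCompactSupport h2
    have i2 : Integrable η₀ := hη₀s.continuous.integrable_of_hasCompactSupport hη₀c
    have hsub : tsupport (fun t => η t - I * η₀ t) ⊆ tsupport η ∪ tsupport η₀ := by
      refine closure_minimal (fun t ht => ?_) ((isClosed_tsupport _).union (isClosed_tsupport _))
      by_contra h'
      rw [mem_union, not_or] at h'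
      apply ht
      simp [image_eq_zero_of_notMem_tsupport h'.1, image_eq_zero_of_notMem_tsupport h'.2]
    obtain ⟨ψ, p1, p2, p3, p4, p5⟩ := exists_primitive (η := fun t => η t - I * η₀ t)
      (h1.sub (contDiff_const.mul hη₀s))
      (HasCompactSupport.of_support_subset_isCompact (IsCompact.union h2 hη₀c)
        ((subset_tsupport _).trans hsub))
      (hsub.trans (union_subset h3 hη₀t))
      (by rw [integral_sub i1 (i2.const_mul I), integral_const_mul, hη₀i]; simp [hI])
    have e := h ψ p1 p2 p3 (by rw [p4]; exact p5)
    rw [p4] at e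
    have j1 := hint η h1 h2 h3
    have j2 := (hint η₀ hη₀s hη₀c hη₀t).const_mul I
    have e' : ∫ t, η t * f t = I * c := by
      have : (fun t => f t * (η t - I * η₀ t)) = fun t => η t * f t - I * (η₀ t * f t) := by
        ext t; ring
      rw [this, integral_sub j1 j2, integral_const_mul] at e
      linarith
    simp only [smul_eq_mul, mul_sub]
    rw [integral_sub j1 (i1.mul_const c), e', integral_mul_const]
    ring
  rw [ae_restrict_iff' measurableSet_Ioo]
  exact key.mono fun x hx hm => sub_eq_zero.1 (hx hm)

/-- Fubini for tails: integrating `r ↦ ∫_{ℓ > r} H` against `η` amounts to integrating `H` against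
the primitive of `η` evaluated at `ℓ`. -/
theorem integral_mul_tail {X : Type*} [MeasurableSpace X] {ν : Measure X} [SFinite ν]
    {ℓ H : X → ℝ} (hℓ : Measurable ℓ) {a : ℝ} (hH : IntegrableOn H {y | a < ℓ y} ν)
    {η : ℝ → ℝ} (hη : Integrable η) (ha : ∀ r ≤ a, η r = 0) :
    ∫ r, η r * ∫ y in {y | r < ℓ y}, H y ∂ν = ∫ y, H y * (∫ r in Iio (ℓ y), η r) ∂ν := by
  have hms : ∀ r, MeasurableSet {y | r < ℓ y} := fun r => measurableSet_lt measurable_const hℓ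
  set H' := {y | a < ℓ y}.indicator H with hH'
  have hi : Integrable H' ν := (integrable_indicator_iff (hms a)).2 hH
  have hpt : ∀ r y, η r * {y | r < ℓ y}.indicator H y =
      {q : ℝ × X | q.1 < ℓ q.2}.indicator (fun q => η q.1 * H' q.2) (r, y) := by
    intro r y
    by_cases h : r < ℓ y
    · rcases le_or_gt r a with h1 | h1
      · simp [ha r h1, indicator]
      · simp [indicator, h, hH', h1.trans h]
    · simp [indicator, h]
  have hpt' : ∀ y r, {q : ℝ × X | q.1 < ℓ q.2}.indicator (fun q => η q.1 * H' q.2) (r, y) =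
      H y * (Iio (ℓ y)).indicator η r := by
    intro y r
    rw [← hpt]
    by_cases h : r < ℓ y <;> simp [indicator, h, mul_comm]
  have hprod : Integrable ({q : ℝ × X | q.1 < ℓ q.2}.indicator (fun q => η q.1 * H' q.2))
      (volume.prod ν) :=
    (hη.mul_prod hi).indicator (measurableSet_lt measurable_fst (hℓ.comp measurable_snd))
  calc ∫ r, η r * ∫ y in {y | r < ℓ y}, H y ∂ν
      = ∫ r, ∫ y, {q : ℝ × X | q.1 < ℓ q.2}.indicator (fun q => η q.1 * H' q.2) (r, y) ∂ν := by
        congr 1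
        ext r
        rw [← integral_indicator (hms r), ← integral_const_mul]
        simp only [hpt]
    _ = ∫ y, (∫ r, {q : ℝ × X | q.1 < ℓ q.2}.indicator (fun q => η q.1 * H' q.2) (r, y)) ∂ν :=
        integral_integral_swap hprod
    _ = _ := by
        simp only [hpt', integral_const_mul, integral_indicator measurableSet_Iio]

/-! ### Testing a weak gradient against radial vector fields -/

theorem hasGradientAt_radial_coord {q : ℝ → ℝ} (hq : Differentiable ℝ q) (i : Fin N) (x : Eu N) :
    HasGradientAt (fun x : Eu N => q (‖x‖ ^ 2) * x i)
      ((2 * deriv q (‖x‖ ^ 2) * x i) • x + q (‖x‖ ^ 2) • EuclideanSpace.single i 1) x := by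
  rw [hasGradientAt_iff_hasFDerivAt]
  have h1 : HasFDerivAt (fun x : Eu N => ‖x‖ ^ 2) (2 • innerSL ℝ x) x :=
    (hasStrictFDerivAt_norm_sq x).hasFDerivAt
  have h2 := (hq (‖x‖ ^ 2)).hasDerivAt.comp_hasFDerivAt x h1
  have h3 : HasFDerivAt (fun x : Eu N => x i) (EuclideanSpace.proj i : Eu N →L[ℝ] ℝ) x :=
    (EuclideanSpace.proj i : Eu N →L[ℝ] ℝ).hasFDerivAt
  refine (h2.mul h3).congr_fderiv ?_
  ext v
  simp [EuclideanSpace.inner_single_left]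
  ring

theorem tsupport_radial_subset {q : ℝ → ℝ} (hs : tsupport q ⊆ Ioo 0 1) (i : Fin N) :
    HasCompactSupport (fun x : Eu N => q (‖x‖ ^ 2) * x i) ∧
      tsupport (fun x : Eu N => q (‖x‖ ^ 2) * x i) ⊆ unitBall N := by
  have hsub : tsupport (fun x : Eu N => q (‖x‖ ^ 2) * x i) ⊆
      (fun x : Eu N => ‖x‖ ^ 2) ⁻¹' tsupport q := by
    refine closure_minimal (fun x hx => ?_) ((isClosed_tsupport q).preimage (by fun_prop))
    by_contra h
    apply hx
    simp [image_eq_zero_of_notMem_tsupport h]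
  have hball : (fun x : Eu N => ‖x‖ ^ 2) ⁻¹' tsupport q ⊆ unitBall N := by
    intro x hx
    have := (hs hx).2
    simp only [mem_ball_zero_iff]
    nlinarith [norm_nonneg x]
  exact ⟨HasCompactSupport.of_support_subset_isCompact (isCompact_closedBall (0 : Eu N) 1)
    ((subset_tsupport _).trans (hsub.trans (hball.trans ball_subset_closedBall))),
    hsub.trans hball⟩

/-- The weak divergence formula for the vector field `x ↦ q(|x|²) x`. -/
theorem HasWeakGradient.integral_radial_field {u : Eu N → ℝ} {G : Eu N → Eu N}
    (h : HasWeakGradient u G) {q : ℝ → ℝ} (hq : ContDiff ℝ ∞ q) (hs : tsupport q ⊆ Ioo 0 1) :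
    ∫ x in unitBall N, u x * (2 * ‖x‖ ^ 2 * deriv q (‖x‖ ^ 2) + N * q (‖x‖ ^ 2)) =
      - ∫ x in unitBall N, q (‖x‖ ^ 2) * inner ℝ x (G x) := by
  have hφ : ∀ i : Fin N, ContDiff ℝ ∞ fun x : Eu N => q (‖x‖ ^ 2) * x i := fun i =>
    (hq.comp (contDiff_norm_sq ℝ)).mul (EuclideanSpace.proj i : Eu N →L[ℝ] ℝ).contDiff
  have hsupp := fun i : Fin N => tsupport_radial_subset (N := N) hs i
  have I1 := fun i => (integrable_smul_gradient (hφ i) (hsupp i).1 (hsupp i).2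
    h.locInt).integrableOn (s := unitBall N)
  have I2 := fun i => (integrable_smul_of_test (hφ i).continuous (hsupp i).1 (hsupp i).2
    h.locInt_grad).integrableOn (s := unitBall N)
  have key : ∀ i : Fin N,
      ∫ x in unitBall N, u x * (2 * deriv q (‖x‖ ^ 2) * x i * x i + q (‖x‖ ^ 2)) =
      - ∫ x in unitBall N, q (‖x‖ ^ 2) * x i * G x i := by
    intro i
    have e := congrArg (EuclideanSpace.proj i : Eu N →L[ℝ] ℝ)
      (h.integral_eq _ (hφ i) (hsupp i).1 (hsupp i).2)
    rw [map_neg, ← ContinuousLinearMap.integral_comp_comm _ (I1 i),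
      ← ContinuousLinearMap.integral_comp_comm _ (I2 i)] at e
    have hg : ∀ x : Eu N, gradient (fun x : Eu N => q (‖x‖ ^ 2) * x i) x = _ := fun x =>
      (hasGradientAt_radial_coord (hq.differentiable (by simp)) i x).gradient
    simp only [hg] at e
    simpa [mul_add] using e
  have J1 : ∀ i ∈ Finset.univ, Integrable
      (fun x : Eu N => u x * (2 * deriv q (‖x‖ ^ 2) * x i * x i + q (‖x‖ ^ 2)))
      (volume.restrict (unitBall N)) := by
    intro i _
    have e := (EuclideanSpace.proj i : Eu N →L[ℝ] ℝ).integrable_comp (I1 i)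
    have hg : ∀ x : Eu N, gradient (fun x : Eu N => q (‖x‖ ^ 2) * x i) x = _ := fun x =>
      (hasGradientAt_radial_coord (hq.differentiable (by simp)) i x).gradient
    simp only [hg] at e
    simpa [mul_add] using e
  have J2 : ∀ i ∈ Finset.univ, Integrable
      (fun x : Eu N => q (‖x‖ ^ 2) * x i * G x i) (volume.restrict (unitBall N)) := by
    intro i _
    simpa using (EuclideanSpace.proj i : Eu N →L[ℝ] ℝ).integrable_comp (I2 i)
  have e := Finset.sum_congr rfl fun i (_ : i ∈ Finset.univ) => key i
  rw [Finset.sum_neg_distrib, ← integral_finsetSum _ J1, ← integral_finsetSum _ J2] at e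
  have s1 : ∀ x : Eu N, ∑ i, u x * (2 * deriv q (‖x‖ ^ 2) * x i * x i + q (‖x‖ ^ 2)) =
      u x * (2 * ‖x‖ ^ 2 * deriv q (‖x‖ ^ 2) + N * q (‖x‖ ^ 2)) := by
    intro x
    have hx : ‖x‖ ^ 2 = ∑ i, x i * x i := by
      rw [EuclideanSpace.real_norm_sq_eq]; simp only [sq]
    rw [← Finset.mul_sum, Finset.sum_add_distrib, Finset.sum_const, Finset.card_univ,
      Fintype.card_fin, nsmul_eq_mul]
    simp only [mul_assoc, ← Finset.mul_sum, ← hx]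
    ring
  have s2 : ∀ x : Eu N, ∑ i, q (‖x‖ ^ 2) * x i * G x i = q (‖x‖ ^ 2) * inner ℝ x (G x) := by
    intro x
    simp only [mul_assoc, ← Finset.mul_sum, PiLp.inner_apply]
    congr 2
    ext i
    simp [mul_comm]
  simpa only [s1, s2] using e

/-- The profile `q` with `q(r²) = ψ(r) / r^N`: the field `q(|x|²) x` has divergence
`ψ'(|x|) / |x|^{N-1}`. -/
theorem exists_profile {ψ : ℝ → ℝ} (hψ : ContDiff ℝ ∞ ψ)
    (hs : tsupport ψ ⊆ Ioo 0 1) :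
    ∃ q : ℝ → ℝ, ContDiff ℝ ∞ q ∧ tsupport q ⊆ Ioo 0 1 ∧
      (∀ r > 0, q (r ^ 2) = ψ r * (r ^ N)⁻¹) ∧
      ∀ r > 0, 2 * r ^ 2 * deriv q (r ^ 2) + N * q (r ^ 2) = deriv ψ r * (r ^ N)⁻¹ * r := by
  set q : ℝ → ℝ := fun s => ψ √s * (√s ^ N)⁻¹ with hq
  have hcl : IsClosed (Real.sqrt ⁻¹' tsupport ψ) := (isClosed_tsupport ψ).preimage
    Real.continuous_sqrt
  have hz : ∀ s, √s ∉ tsupport ψ → q s = 0 := fun s h => by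
    simp [hq, image_eq_zero_of_notMem_tsupport h]
  have hval : ∀ r > 0, q (r ^ 2) = ψ r * (r ^ N)⁻¹ := fun r hr => by
    simp only [hq, Real.sqrt_sq hr.le]
  have hsm : ContDiff ℝ ∞ q := by
    rw [contDiff_iff_contDiffAt]
    intro s
    by_cases h : √s ∈ tsupport ψ
    · have h0 : 0 < s := Real.sqrt_pos.1 (hs h).1
      have h1 : ContDiffAt ℝ ∞ Real.sqrt s := Real.contDiffAt_sqrt h0.ne'
      exact (hψ.contDiffAt.comp s h1).mul ((h1.pow N).inv (pow_pos (hs h).1 N).ne')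
    · refine contDiffAt_const (c := (0 : ℝ)).congr_of_eventuallyEq ?_
      filter_upwards [hcl.isOpen_compl.mem_nhds h] with t ht using hz t ht
  refine ⟨q, hsm, ?_, hval, ?_⟩
  · have h1 : tsupport q ⊆ Real.sqrt ⁻¹' tsupport ψ :=
      closure_minimal (fun s h => by_contra fun h' => h (hz s h')) hcl
    intro s h
    have h2 := hs (h1 h)
    have h3 := Real.sqrt_pos.1 h2.1
    exact ⟨h3, by nlinarith [Real.sq_sqrt h3.le, h2.1, h2.2]⟩
  · intro r hr
    have hrN := pow_pos hr N
    have d1 : HasDerivAt (fun r => q (r ^ 2)) (deriv q (r ^ 2) * (2 * r)) r := by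
      have h1 : HasDerivAt (fun r : ℝ => r ^ 2) (2 * r) r := by simpa using hasDerivAt_pow 2 r
      exact ((hsm.differentiable (by simp)) (r ^ 2)).hasDerivAt.comp r h1
    have d2 : HasDerivAt (fun r => ψ r * (r ^ N)⁻¹)
        (deriv ψ r * (r ^ N)⁻¹ + ψ r * (-(N * r ^ (N - 1)) / (r ^ N) ^ 2)) r :=
      ((hψ.differentiable (by simp)) r).hasDerivAt.mul ((hasDerivAt_pow N r).inv hrN.ne')
    have e := d1.unique (d2.congr_of_eventuallyEq (by
      filter_upwards [lt_mem_nhds hr] with t ht using hval t ht))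
    rw [hval r hr]
    have e2 : 2 * r ^ 2 * deriv q (r ^ 2) = (deriv q (r ^ 2) * (2 * r)) * r := by ring
    rw [e2, e]
    rcases Nat.eq_zero_or_pos N with h0 | h0
    · subst h0; simp
    · obtain ⟨n, rfl⟩ := Nat.exists_eq_succ_of_ne_zero h0.ne'
      simp only [Nat.succ_eq_add_one, Nat.add_sub_cancel]
      field_simp
      ring

/-- One-dimensional form of the weak gradient identity for a radial function `u(x) = f(|x|)`, with
the hyperbolic gradient `g = G / ρ` paired with the field defining the kernel. -/
theorem HasWeakGradient.integral_deriv [NeZero N] {u : Eu N → ℝ} {G g : Eu N → Eu N}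
    {f : ℝ → ℝ} (h : HasWeakGradient u G) (hf : u =ᵐ[hypVol N] fun x => f ‖x‖)
    (hg : g =ᵐ[hypVol N] fun x => (conf x)⁻¹ • G x) {ψ : ℝ → ℝ} (hψ : ContDiff ℝ ∞ ψ)
    (hs : tsupport ψ ⊆ Ioo 0 1) :
    ∫ r in Ioo 0 1, f r * deriv ψ r =
      ∫ y, kerCoef N ‖y‖ * inner ℝ y (g y) * ψ ‖y‖ ∂(hypVol N) := by
  obtain ⟨q, hq, hqs, hq1, hq2⟩ := exists_profile (N := N) hψ hs
  have hw := (sphereArea_pos (N := N)).ne'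
  have e := h.integral_radial_field hq hqs
  have hne : ∀ᵐ x : Eu N ∂(volume.restrict (unitBall N)), x ≠ 0 := by
    refine ae_restrict_of_ae ?_
    have : Nonempty (Fin N) := ⟨⟨0, Nat.pos_of_neZero N⟩⟩
    exact Measure.ae_ne volume 0
  have e1 : ∫ x in unitBall N, u x * (2 * ‖x‖ ^ 2 * deriv q (‖x‖ ^ 2) + N * q (‖x‖ ^ 2)) =
      sphereArea N * ∫ r in Ioo 0 1, f r * deriv ψ r := by
    calc _ = ∫ x in unitBall N, f ‖x‖ * (deriv ψ ‖x‖ * (‖x‖ ^ N)⁻¹ * ‖x‖) := by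
          refine integral_congr_ae ?_
          filter_upwards [(ac_hypVol N).ae_le hf, hne] with x hx hx0
          rw [hx, hq2 _ (norm_pos_iff.2 hx0)]
      _ = _ := by
          rw [setIntegral_ball_radial fun r => f r * (deriv ψ r * (r ^ N)⁻¹ * r)]
          congr 1
          refine setIntegral_congr_fun measurableSet_Ioo fun r hr => ?_
          have hr0 := hr.1.ne'
          have hN : r ^ N = r ^ (N - 1) * r := by
            rw [← pow_succ, Nat.sub_add_cancel (Nat.pos_of_neZero N)]
          rw [hN]
          field_simp
  have e2 : ∫ x in unitBall N, q (‖x‖ ^ 2) * inner ℝ x (G x) =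
      - (sphereArea N * ∫ y, kerCoef N ‖y‖ * inner ℝ y (g y) * ψ ‖y‖ ∂(hypVol N)) := by
    rw [integral_hypVol, ← integral_const_mul, ← integral_neg]
    refine integral_congr_ae ?_
    filter_upwards [(ac_hypVol N).ae_le hg, hne, ae_restrict_mem measurableSet_ball]
      with x hx hx0 hxb
    have hr := norm_pos_iff.2 hx0
    have ht := (invConf_pos hr.le (mem_ball_zero_iff.1 hxb)).ne'
    rw [hq1 _ hr, hx, inv_conf, real_inner_smul_right, smul_eq_mul, kerCoef]
    have hN : invConf ‖x‖ ^ N = invConf ‖x‖ ^ (N - 1) * invConf ‖x‖ := by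
      rw [← pow_succ, Nat.sub_add_cancel (Nat.pos_of_neZero N)]
    rw [hN]
    have hr' := hr.ne'
    field_simp
  rw [e1, e2, neg_neg] at e
  exact mul_left_cancel₀ hw e

/-! ### Representation of radial Sobolev functions -/

/-- Away from the origin the radial volume density is bounded below, so local integrability passes
from the ball to the interval of radii. -/
theorem locallyIntegrableOn_profile [NeZero N] {u : Eu N → ℝ} {f : ℝ → ℝ}
    (hu : LocallyIntegrableOn u (unitBall N)) (hf : u =ᵐ[hypVol N] fun x => f ‖x‖) :
    LocallyIntegrableOn f (Ioo 0 1) := by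
  rw [locallyIntegrableOn_iff isOpen_Ioo.isLocallyClosed]
  intro K hK hc
  have hKm : MeasurableSet K := hc.isClosed.measurableSet
  set A : Set (Eu N) := norm ⁻¹' K with hA
  have hAb : A ⊆ unitBall N := fun x hx => mem_ball_zero_iff.2 (hK hx).2
  have hAc : IsCompact A := (isCompact_closedBall (0 : Eu N) 1).of_isClosed_subset
    (hc.isClosed.preimage continuous_norm) (hAb.trans ball_subset_closedBall)
  have h1 : IntegrableOn u A := hu.integrableOn_compact_subset hAb hAc
  have h2 : IntegrableOn (fun x : Eu N => f ‖x‖) A :=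
    h1.congr_fun_ae (ae_restrict_of_ae_restrict_of_subset hAb ((ac_hypVol N).ae_le hf))
  have h3 : IntegrableOn (fun x : Eu N => K.indicator f ‖x‖) (unitBall N) := by
    have e : (fun x : Eu N => K.indicator f ‖x‖) = A.indicator fun x => f ‖x‖ := by
      ext x
      by_cases hx : ‖x‖ ∈ K <;> simp [hx, hA]
    rw [e]
    exact ((integrable_indicator_iff (hKm.preimage measurable_norm)).2 h2).integrableOn
  have h4 := (integrableOn_ball_radial.1 h3).mono_set hK
  have h5 := h4.continuousOn_mul (g := fun r => (r ^ (N - 1))⁻¹)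
    (fun r hr => ((continuousAt_id.pow _).inv₀
      (pow_ne_zero _ (hK hr).1.ne')).continuousWithinAt) hc
  refine h5.congr_fun (fun r hr => ?_) hKm
  have := (hK hr).1.ne'
  simp only [indicator_of_mem hr]
  field_simp

theorem hypVol_norm_gt [NeZero N] {s : ℝ} (hs : s < 1) : hypVol N {x | s < ‖x‖} = ⊤ := by
  by_contra hfin
  set t := max s (1 / 2) with ht
  have ht1 : t < 1 := max_lt hs (by norm_num)
  have ht0 : 1 / 2 ≤ t := le_max_right _ _
  have hms : MeasurableSet {x : Eu N | s < ‖x‖} := measurableSet_lt measurable_const measurable_norm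
  have h1 : Integrable (fun x : Eu N => (Ioi s).indicator (fun _ => (1 : ℝ)) ‖x‖) (hypVol N) := by
    have e : (fun x : Eu N => (Ioi s).indicator (fun _ => (1 : ℝ)) ‖x‖) =
        {x : Eu N | s < ‖x‖}.indicator fun _ => 1 := by
      ext x
      by_cases hx : s < ‖x‖ <;> simp [hx]
    rw [e, integrable_indicator_iff hms]
    exact integrableOn_const hfin
  have h2 := ((integrable_hypVol_radial.1 h1).mono_set
    (Ioo_subset_Ioo_left (by linarith : (0 : ℝ) ≤ t))).const_mul ((1 / 2 : ℝ) ^ (N - 1))⁻¹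
  have h3 : IntegrableOn (fun r : ℝ => (r - 1)⁻¹) (Ioo t 1) := by
    refine Integrable.mono' h2 (Measurable.aestronglyMeasurable (by fun_prop)) ?_
    refine (ae_restrict_mem measurableSet_Ioo).mono fun r hr => ?_
    have hr0 : 1 / 2 < r := ht0.trans_lt hr.1
    have hi := invConf_pos (by linarith : 0 ≤ r) hr.2
    have hsr : s < r := (le_max_left _ _).trans_lt hr.1
    have h1r : 0 < 1 - r := by linarith [hr.2]
    rw [indicator_of_mem (mem_Ioi.2 hsr), mul_one, norm_inv, Real.norm_eq_abs, abs_sub_comm,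
      abs_of_pos h1r]
    have hle : invConf r ^ N ≤ 1 - r := by
      calc invConf r ^ N ≤ invConf r ^ 1 := pow_le_pow_of_le_one hi.le
            ((invConf_le r).trans (by linarith)) (Nat.pos_of_neZero N)
        _ ≤ 1 - r := by rw [pow_one]; exact invConf_le r
    calc (1 - r)⁻¹ ≤ (invConf r ^ N)⁻¹ := by gcongr
      _ = ((1 / 2 : ℝ) ^ (N - 1))⁻¹ * ((1 / 2) ^ (N - 1) * (invConf r ^ N)⁻¹) := by
          field_simp
      _ ≤ _ := by gcongr
  have h4 := (intervalIntegrable_iff_integrableOn_Ioo_of_le ht1.le).2 h3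
  rw [intervalIntegrable_sub_inv_iff] at h4
  rcases h4 with h4 | h4
  · exact ht1.ne h4
  · exact h4 right_mem_uIcc

theorem tendsto_norm_radKer [NeZero N] (hN : 3 ≤ N) :
    Filter.Tendsto (fun r => ‖radKer N r‖) (nhdsWithin 1 (Iio 1)) (nhds 0) := by
  have h1 : Filter.Tendsto
      (fun r : ℝ => √((sphereArea N)⁻¹ * ((r ^ (N - 2))⁻¹ * (1 - r) ^ (N - 1))))
      (nhdsWithin 1 (Iio 1)) (nhds 0) := by
    have h2 : ContinuousAt
        (fun r : ℝ => √((sphereArea N)⁻¹ * ((r ^ (N - 2))⁻¹ * (1 - r) ^ (N - 1)))) 1 := by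
      refine Real.continuous_sqrt.continuousAt.comp (continuousAt_const.mul
        (((continuousAt_id.pow _).inv₀ (by simp)).mul (by fun_prop)))
    have h3 := h2.tendsto.mono_left (nhdsWithin_le_nhds (s := Iio 1))
    simpa [show N - 1 ≠ 0 by omega] using h3
  refine squeeze_zero' (Filter.Eventually.of_forall fun _ => norm_nonneg _) ?_ h1
  filter_upwards [self_mem_nhdsWithin, nhdsWithin_le_nhds (lt_mem_nhds (zero_lt_one' ℝ))]
    with r hr hr0
  exact Real.le_sqrt_of_sq_le (norm_radKer_sq_le hN hr0 hr)

/-- A radial function is recovered, up to a constant, from its hyperbolic gradient. -/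
theorem exists_const_profile [NeZero N] (hN : 2 ≤ N) {u : Eu N → ℝ} {G : Eu N → Eu N}
    {f : ℝ → ℝ} (h : HasWeakGradient u G) (hf : u =ᵐ[hypVol N] fun x => f ‖x‖)
    (g : Lp (Eu N) 2 (hypVol N)) (hg : g =ᵐ[hypVol N] fun x => (conf x)⁻¹ • G x) :
    ∃ c, ∀ᵐ r ∂(volume.restrict (Ioo (0 : ℝ) 1)), f r = inner ℝ (radKer N r) g + c := by
  have hfl := locallyIntegrableOn_profile h.locInt hf
  have hcont : ContinuousOn (fun r => inner ℝ (radKer N r) g) (Ioo 0 1) :=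
    ((continuousOn_radKer hN).mono Ioo_subset_Ioi_self).inner continuousOn_const
  have hFl : LocallyIntegrableOn (fun r => inner ℝ (radKer N r) g) (Ioo 0 1) :=
    hcont.locallyIntegrableOn measurableSet_Ioo
  refine (ae_const_of_weak_deriv_zero (hfl.sub hFl) fun ψ p1 p2 p3 p4 => ?_).imp fun c hc =>
    hc.mono fun r hr => eq_add_of_sub_eq' hr
  have d1 : ContDiff ℝ ∞ (deriv ψ) := (contDiff_infty_iff_deriv.1 p1).2
  have hsub : tsupport (deriv ψ) ⊆ tsupport ψ := tsupport_deriv_subset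
  have d2 : HasCompactSupport (deriv ψ) := p2.deriv
  obtain ⟨a, ha, haψ⟩ : ∃ a : ℝ, 0 < a ∧ ∀ r ≤ a, deriv ψ r = 0 := by
    rcases (tsupport ψ).eq_empty_or_nonempty with he | hne
    · refine ⟨1, one_pos, fun r _ => image_eq_zero_of_notMem_tsupport fun hr => ?_⟩
      simpa [he] using hsub hr
    · obtain ⟨b, hb, hb'⟩ := IsCompact.exists_isLeast p2 hne
      have hb0 := (p3 hb).1
      refine ⟨b / 2, half_pos hb0, fun r hr => image_eq_zero_of_notMem_tsupport fun h' => ?_⟩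
      have := hb' (hsub h')
      linarith
  have hi : ∀ φ : ℝ → ℝ, LocallyIntegrableOn φ (Ioo 0 1) →
      Integrable (fun r => φ r * deriv ψ r) := by
    intro φ hφ
    have h4 : IntegrableOn φ (tsupport (deriv ψ)) :=
      hφ.integrableOn_compact_subset (hsub.trans p3) d2
    refine (integrableOn_iff_integrable_of_support_subset ?_).1
      (h4.mul_continuousOn d1.continuous.continuousOn d2)
    exact (Function.support_mul_subset_right φ _).trans (subset_tsupport _)
  simp only [Pi.sub_apply, sub_mul]
  rw [integral_sub (hi _ hfl) (hi _ hFl), sub_eq_zero]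
  have e1 : ∫ r, f r * deriv ψ r = ∫ r in Ioo 0 1, f r * deriv ψ r := by
    refine (setIntegral_eq_integral_of_forall_compl_eq_zero fun r hr => ?_).symm
    rw [image_eq_zero_of_notMem_tsupport fun h' => hr (p3 (hsub h')), mul_zero]
  have : SFinite (hypVol N) := by unfold hypVol; infer_instance
  have e2 := integral_mul_tail (measurable_norm (α := Eu N)) (inner_radKer hN ha g).1
    (d1.continuous.integrable_of_hasCompactSupport d2) haψ
  simp only [p4] at e2
  rw [e1, h.integral_deriv hf hg p1 p3, ← e2]
  congr 1
  ext r
  rcases le_or_gt r a with hr | hr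
  · simp [haψ r hr]
  · rw [(inner_radKer hN (ha.trans hr) g).2, mul_comm]

/-- Radial Sobolev functions are recovered from their hyperbolic gradient. The constant of
integration vanishes because the function is square-integrable while the volume is infinite. -/
theorem toL2_ae_eq [NeZero N] (hN : 3 ≤ N) (u : H1r N) :
    u.toL2 =ᵐ[hypVol N] fun x => inner ℝ (radKer N ‖x‖) (H1r.grad N u) := by
  obtain ⟨⟨G, hG, hG2⟩, f, hfm, hf⟩ := u.2
  have hg : H1r.grad N u =ᵐ[hypVol N] fun x => (conf x)⁻¹ • G x :=
    hypGrad_ae_eq (Submodule.inclusion inf_le_left u) hG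
  obtain ⟨c, hc⟩ := exists_const_profile (by omega) hG hf (H1r.grad N u) hg
  have hc' := ae_norm_of_ae (N := N) hc
  have hu : ∀ᵐ x ∂(hypVol N), u.toL2 x = inner ℝ (radKer N ‖x‖) (H1r.grad N u) + c := by
    filter_upwards [hf, hc'] with x h1 h2
    exact h1.trans h2
  -- if `c ≠ 0` then `|u| ≥ |c| / 2` outside some ball, a set of infinite volume
  suffices c = 0 from hu.mono fun x hx => by rw [hx, this, add_zero]
  by_contra hne
  have hlim : Filter.Tendsto (fun r => ‖radKer N r‖ * ‖H1r.grad N u‖) (nhdsWithin 1 (Iio 1))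
      (nhds 0) := by
    simpa using (tendsto_norm_radKer hN).mul_const ‖H1r.grad N u‖
  have hc2 : 0 < |c| / 2 := by positivity
  obtain ⟨s, hs1, hs⟩ := (mem_nhdsLT_iff_exists_Ioo_subset).1 (hlim.eventually (gt_mem_nhds hc2))
  have hfin := (Lp.memLp u.toL2).meas_ge_lt_top (by simp) (by simp) (ε := ⟨|c| / 2, hc2.le⟩)
    (fun h => hc2.ne' (congrArg NNReal.toReal h))
  refine hfin.ne (top_le_iff.1 ?_)
  rw [← hypVol_norm_gt (N := N) hs1]
  refine measure_mono_ae ?_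
  filter_upwards [hu, ae_hypVol_mem_ball] with x hx hxb hsx
  have h1 : ‖radKer N ‖x‖‖ * ‖H1r.grad N u‖ < |c| / 2 := hs ⟨hsx, mem_ball_zero_iff.1 hxb⟩
  have h2 := abs_real_inner_le_norm (radKer N ‖x‖) (H1r.grad N u)
  have h3 : |c| ≤ |inner ℝ (radKer N ‖x‖) (H1r.grad N u) + c| +
      |inner ℝ (radKer N ‖x‖) (H1r.grad N u)| := by
    have := abs_sub (inner ℝ (radKer N ‖x‖) (H1r.grad N u) + c)
      (inner ℝ (radKer N ‖x‖) (H1r.grad N u))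
    simpa using this
  change |c| / 2 ≤ ‖u.toL2 x‖
  rw [hx, Real.norm_eq_abs]
  linarith

/-! ### Integrability of the weighted kernel -/

/-- Convergence of the Beta integral with real exponents. -/
theorem integrableOn_rpow_mul_one_sub_rpow {a b : ℝ} (ha : -1 < a) (hb : -1 < b) :
    IntegrableOn (fun r : ℝ => r ^ a * (1 - r) ^ b) (Ioo 0 1) := by
  have h := Complex.betaIntegral_convergent (u := ((a + 1 : ℝ) : ℂ)) (v := ((b + 1 : ℝ) : ℂ))
    (by rw [Complex.ofReal_re]; linarith) (by rw [Complex.ofReal_re]; linarith)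
  refine ((intervalIntegrable_iff_integrableOn_Ioo_of_le zero_le_one).1 h).norm.congr ?_
  refine (ae_restrict_mem measurableSet_Ioo).mono fun r hr => ?_
  have h1 : 0 < 1 - r := by linarith [hr.2]
  have e : (1 : ℂ) - (r : ℂ) = ((1 - r : ℝ) : ℂ) := by push_cast; rfl
  beta_reduce
  rw [norm_mul, e, Complex.norm_cpow_eq_rpow_re_of_pos hr.1,
    Complex.norm_cpow_eq_rpow_re_of_pos h1]
  simp

/-- The geodesic distance is linear near the origin and grows slower than any negative power of
`1 - r` at infinity. -/
theorem log_ratio_le {r ε : ℝ} (h0 : 0 < r) (h1 : r < 1) (hε : 0 < ε) (hε1 : ε ≤ 1) :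
    Real.log ((1 + r) / (1 - r)) ≤ 4 / ε * (r * (1 - r) ^ (-ε)) := by
  have h2 : 0 < 1 - r := by linarith
  have hy : 0 < (1 + r) / (1 - r) := by positivity
  have hone : 1 ≤ (1 - r) ^ (-ε) := Real.one_le_rpow_of_pos_of_le_one_of_nonpos h2
    (by linarith) (by linarith)
  rcases le_or_gt r (1 / 2) with h | h
  · calc Real.log ((1 + r) / (1 - r)) ≤ (1 + r) / (1 - r) - 1 := Real.log_le_sub_one_of_pos hy
      _ = 2 * r / (1 - r) := by field_simp; ring
      _ ≤ 4 / 1 * (r * 1) := by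
          rw [div_le_iff₀ h2]; nlinarith
      _ ≤ 4 / ε * (r * (1 - r) ^ (-ε)) := by gcongr
  · calc Real.log ((1 + r) / (1 - r)) ≤ ((1 + r) / (1 - r)) ^ ε / ε :=
          Real.log_le_rpow_div hy.le hε
      _ ≤ (2 / (1 - r)) ^ ε / ε := by gcongr; linarith
      _ = 2 ^ ε * (1 - r) ^ (-ε) / ε := by
          rw [Real.div_rpow zero_le_two h2.le, Real.rpow_neg h2.le, div_eq_mul_inv (2 ^ ε)]
      _ ≤ 2 ^ (1 : ℝ) * (1 - r) ^ (-ε) / ε := by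
          gcongr
          norm_num
      _ = 4 / ε * (1 / 2 * (1 - r) ^ (-ε)) := by rw [Real.rpow_one]; ring
      _ ≤ 4 / ε * (r * (1 - r) ^ (-ε)) := by gcongr

theorem norm_radKer_le [NeZero N] (hN : 3 ≤ N) {r : ℝ} (h0 : 0 < r) (h1 : r < 1) :
    ‖radKer N r‖ ≤ √(sphereArea N)⁻¹ *
      (r ^ (-((N : ℝ) - 2) / 2) * (1 - r) ^ (((N : ℝ) - 1) / 2)) := by
  have h2 : 0 < 1 - r := by linarith
  have hw := sphereArea_pos (N := N)
  refine le_of_sq_le_sq ((norm_radKer_sq_le hN h0 h1).trans_eq ?_) (by positivity)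
  rw [mul_pow, Real.sq_sqrt (by positivity), mul_pow]
  congr 2
  · rw [← Real.rpow_mul_natCast h0.le, ← Real.rpow_natCast, ← Real.rpow_neg h0.le,
      Nat.cast_sub (by omega)]
    congr 1
    push_cast
    ring
  · rw [← Real.rpow_mul_natCast h2.le, ← Real.rpow_natCast, Nat.cast_sub (by omega)]
    congr 1
    push_cast
    ring

/-- Power-type radial functions in `L^p(𝔹^N, dV)`. -/
theorem memLp_rpow_mul_one_sub_rpow [NeZero N] {p a b : ℝ} (hp : 0 < p) (ha : 0 < a * p + N)
    (hb : N - 1 < b * p) :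
    MemLp (fun x : Eu N => ‖x‖ ^ a * (1 - ‖x‖) ^ b) (ENNReal.ofReal p) (hypVol N) := by
  have hp0 : ENNReal.ofReal p ≠ 0 := by simpa using hp
  rw [← integrable_norm_rpow_iff (Measurable.aestronglyMeasurable (by fun_prop)) hp0
    ENNReal.ofReal_ne_top, ENNReal.toReal_ofReal hp.le]
  refine (integrable_hypVol_radial (N := N)
    (f := fun r : ℝ => ‖r ^ a * (1 - r) ^ b‖ ^ p)).2 ?_
  have hi := (integrableOn_rpow_mul_one_sub_rpow (a := a * p + N - 1) (b := b * p - N)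
    (by linarith) (by linarith)).const_mul ((2 : ℝ) ^ N)
  refine Integrable.mono' hi (Measurable.aestronglyMeasurable ?_) ?_
  · unfold invConf; fun_prop
  refine (ae_restrict_mem measurableSet_Ioo).mono fun r hr => ?_
  have h0 := hr.1
  have h1 : 0 < 1 - r := by linarith [hr.2]
  have ht := invConf_pos h0.le hr.2
  rw [Real.norm_of_nonneg (by positivity), Real.norm_of_nonneg (by positivity),
    Real.mul_rpow (by positivity) (by positivity), ← Real.rpow_mul h0.le, ← Real.rpow_mul h1.le]
  have hr1 : r ^ (N - 1) = r ^ ((N : ℝ) - 1) := by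
    rw [← Real.rpow_natCast, Nat.cast_sub (Nat.pos_of_neZero N), Nat.cast_one]
  have hinv : (invConf r ^ N)⁻¹ ≤ 2 ^ N * (1 - r) ^ (-(N : ℝ)) := by
    rw [Real.rpow_neg h1.le, Real.rpow_natCast, ← div_eq_mul_inv, ← div_pow, ← inv_pow]
    gcongr
    rw [inv_le_comm₀ ht (by positivity), inv_div]
    exact le_invConf h0.le hr.2.le
  calc r ^ (N - 1) * ((invConf r ^ N)⁻¹ * (r ^ (a * p) * (1 - r) ^ (b * p)))
      ≤ r ^ (N - 1) * (2 ^ N * (1 - r) ^ (-(N : ℝ)) * (r ^ (a * p) * (1 - r) ^ (b * p))) := by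
        gcongr
    _ = 2 ^ N * ((r ^ (a * p) * r ^ ((N : ℝ) - 1)) *
          ((1 - r) ^ (b * p) * (1 - r) ^ (-(N : ℝ)))) := by
        rw [hr1]; ring
    _ = 2 ^ N * (r ^ (a * p + N - 1) * (1 - r) ^ (b * p - N)) := by
        rw [← Real.rpow_add h0, ← Real.rpow_add h1]
        congr 3
        ring

theorem hypDist_nonneg {x : Eu N} (hx : ‖x‖ < 1) : 0 ≤ hypDist x := by
  have h := norm_nonneg x
  refine Real.log_nonneg ?_
  rw [le_div_iff₀ (by linarith)]
  linarith

theorem ae_hypVol_norm_pos [NeZero N] : ∀ᵐ x ∂(hypVol N), 0 < ‖x‖ := by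
  have : Nonempty (Fin N) := ⟨⟨0, Nat.pos_of_neZero N⟩⟩
  have h : ∀ᵐ x : Eu N ∂(volume.restrict (unitBall N)), x ≠ 0 :=
    ae_restrict_of_ae (Measure.ae_ne volume 0)
  filter_upwards [ae_hypVol_iff.2 h] with x hx
  exact norm_pos_iff.2 hx

theorem aestronglyMeasurable_kernel [NeZero N] (hN : 2 ≤ N) (m : ℝ) :
    AEStronglyMeasurable (fun x : Eu N => hypDist x ^ m • radKer N ‖x‖) (hypVol N) := by
  have hd : Measurable fun x : Eu N => hypDist x ^ m := by unfold hypDist; fun_prop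
  refine hd.aestronglyMeasurable.smul ?_
  have hopen : IsOpen {x : Eu N | 0 < ‖x‖} := isOpen_lt continuous_const continuous_norm
  have h : ContinuousOn (fun x : Eu N => radKer N ‖x‖) {x | 0 < ‖x‖} :=
    (continuousOn_radKer hN).comp continuous_norm.continuousOn fun x hx => hx
  have h2 := h.aestronglyMeasurable (μ := hypVol N) hopen.measurableSet
  have e : (hypVol N).restrict {x : Eu N | 0 < ‖x‖} = hypVol N :=
    Measure.restrict_eq_self_of_ae_mem ae_hypVol_norm_pos
  rwa [e] at h2

/-- The weighted kernel `x ↦ d(x)^m k_{|x|}` is `p`-integrable: subcriticality of `p` is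
integrability at the origin, and `p > 2` gives integrability at infinity. -/
theorem memLp_kernel [NeZero N] (hN : 3 ≤ N) {m p : ℝ} (hm : 0 < m) (hp : 2 < p)
    (hcrit : 0 < (m - ((N : ℝ) - 2) / 2) * p + N) :
    MemLp (fun x : Eu N => hypDist x ^ m • radKer N ‖x‖) (ENNReal.ofReal p) (hypVol N) := by
  have hN' : (3 : ℝ) ≤ N := by exact_mod_cast hN
  -- the logarithm costs a power `(1 - r)^{-ε m}`, affordable since `(N - 1)(p / 2 - 1) > 0`
  obtain ⟨ε, hε, hε1, hεp⟩ :
      ∃ ε : ℝ, 0 < ε ∧ ε ≤ 1 ∧ ε * (m * p) < ((N : ℝ) - 1) * (p / 2 - 1) := by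
    have hmp : 0 < m * p := by positivity
    have hpos : 0 < ((N : ℝ) - 1) * (p / 2 - 1) := mul_pos (by linarith) (by linarith)
    refine ⟨min 1 (((N : ℝ) - 1) * (p / 2 - 1) / (2 * (m * p))), by positivity, min_le_left _ _, ?_⟩
    calc _ ≤ ((N : ℝ) - 1) * (p / 2 - 1) / (2 * (m * p)) * (m * p) := by
          gcongr; exact min_le_right _ _
      _ = ((N : ℝ) - 1) * (p / 2 - 1) / 2 := by field_simp
      _ < _ := by linarith
  have hbase := memLp_rpow_mul_one_sub_rpow (N := N) (p := p) (a := m - ((N : ℝ) - 2) / 2)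
    (b := ((N : ℝ) - 1) / 2 - ε * m) (by linarith) hcrit (by nlinarith)
  refine hbase.of_le_mul (c := (4 / ε) ^ m * √(sphereArea N)⁻¹)
    (aestronglyMeasurable_kernel (by omega) m) ?_
  filter_upwards [ae_hypVol_norm_pos, ae_hypVol_mem_ball] with x h0 hx
  have h1 : ‖x‖ < 1 := mem_ball_zero_iff.1 hx
  have h2 : 0 < 1 - ‖x‖ := by linarith
  have hd := hypDist_nonneg h1
  have hd' : hypDist x ≤ 4 / ε * (‖x‖ * (1 - ‖x‖) ^ (-ε)) := log_ratio_le h0 h1 hε hε1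
  rw [norm_smul, Real.norm_of_nonneg (by positivity), Real.norm_of_nonneg (by positivity)]
  calc hypDist x ^ m * ‖radKer N ‖x‖‖
      ≤ (4 / ε * (‖x‖ * (1 - ‖x‖) ^ (-ε))) ^ m * (√(sphereArea N)⁻¹ *
        (‖x‖ ^ (-((N : ℝ) - 2) / 2) * (1 - ‖x‖) ^ (((N : ℝ) - 1) / 2))) := by
        gcongr
        exact norm_radKer_le hN h0 h1
    _ = (4 / ε) ^ m * √(sphereArea N)⁻¹ * ((‖x‖ ^ m * ‖x‖ ^ (-((N : ℝ) - 2) / 2)) *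
        ((1 - ‖x‖) ^ (((N : ℝ) - 1) / 2) * (1 - ‖x‖) ^ (-ε * m))) := by
        rw [Real.mul_rpow (by positivity) (by positivity),
          Real.mul_rpow (by positivity) (by positivity), ← Real.rpow_mul h2.le]
        ring
    _ = _ := by
        rw [← Real.rpow_add h0, ← Real.rpow_add h2]
        congr 3 <;> ring

/-- Subcriticality of `p`, restated as the integrability condition at the origin; it holds for every
`p > 0` when `m ≥ (N - 2) / 2`. -/
theorem pos_of_lt_critExp (hN : 0 < N) {m p : ℝ} (hp : 0 < p) (h : (p : EReal) < critExp N m) :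
    0 < (m - ((N : ℝ) - 2) / 2) * p + N := by
  have hN' : (0 : ℝ) < N := by exact_mod_cast hN
  unfold critExp at h
  split_ifs at h with hm
  · rw [EReal.coe_lt_coe_iff, lt_div_iff₀ (by linarith)] at h
    nlinarith
  · nlinarith [not_lt.1 hm]

/-! ### The weighted embedding -/

/-- The hyperbolic gradient as a continuous map, isometric by the choice of norm on `H1r N`. -/
def gradL (N : ℕ) : H1r N →L[ℝ] Lp (Eu N) 2 (hypVol N) :=
  (H1r.grad N).mkContinuous 1 fun u => by rw [one_mul]; exact le_of_eq rfl

/-- The weighted embedding of a single copy of `H¹_r(𝔹^N)`. -/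
theorem exists_compact_embedding (hN : 3 ≤ N) {m p : ℝ} (hm : 0 < m) (hp : 2 < p)
    (hp' : (p : EReal) < critExp N m) [Fact (1 ≤ ENNReal.ofReal p)] :
    ∃ S : H1r N →L[ℝ] Lp ℝ (ENNReal.ofReal p) (hypVol N),
      (∀ u : H1r N, S u =ᵐ[hypVol N] fun x => hypDist x ^ m * u.toL2 x) ∧ IsCompactOperator S := by
  have : NeZero N := ⟨by omega⟩
  have hκ := memLp_kernel hN hm hp (pos_of_lt_critExp (by omega) (by linarith) hp')
  refine ⟨(kernelOp (Lp (Eu N) 2 (hypVol N)) (hypVol N) (ENNReal.ofReal p) hκ.toLp).comp (gradL N),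
    fun u => ?_, ?_⟩
  swap
  · rw [ContinuousLinearMap.coe_comp]
    exact (isCompactOperator_kernelOp ENNReal.ofReal_ne_top hκ.toLp).comp_clm (gradL N)
  filter_upwards [kernelOp_apply_ae hκ.toLp (gradL N u), hκ.coeFn_toLp, toL2_ae_eq hN u]
    with x h1 h2 h3
  rw [ContinuousLinearMap.comp_apply, h1, h2, h3, real_inner_smul_right, real_inner_comm]
  rfl

end Hyperbolic

end

theorem mainTheorem2 (N : ℕ) (hN : 3 ≤ N) (m : ℝ) (hm : 0 < m) (p : ℝ) (hp : 2 < p)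
    (hp' : (p : EReal) < Hyperbolic.critExp N m) [Fact (1 ≤ ENNReal.ofReal p)] :
    ∃ T : Hyperbolic.HSpace N →L[ℝ] Hyperbolic.LpPair N (ENNReal.ofReal p),
      (∀ w : Hyperbolic.HSpace N,
        ((T w).fst =ᵐ[Hyperbolic.hypVol N] fun x => Hyperbolic.hypDist x ^ m * w.fst.toL2 x) ∧
        ((T w).snd =ᵐ[Hyperbolic.hypVol N] fun x => Hyperbolic.hypDist x ^ m * w.snd.toL2 x)) ∧
      IsCompactOperator T := by
  obtain ⟨S, hS, hSc⟩ := Hyperbolic.exists_compact_embedding hN hm hp hp'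
  let Y := Lp ℝ (ENNReal.ofReal p) (Hyperbolic.hypVol N)
  let E := (WithLp.prodContinuousLinearEquiv (ENNReal.ofReal p) ℝ Y Y).symm.toContinuousLinearMap
  let A := E.comp (ContinuousLinearMap.inl ℝ Y Y)
  let B := E.comp (ContinuousLinearMap.inr ℝ Y Y)
  let P := WithLp.fstL 2 ℝ (Hyperbolic.H1r N) (Hyperbolic.H1r N)
  let Q := WithLp.sndL 2 ℝ (Hyperbolic.H1r N) (Hyperbolic.H1r N)
  refine ⟨A.comp (S.comp P) + B.comp (S.comp Q), fun w => ⟨?_, ?_⟩, ?_⟩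
  · have : ((A.comp (S.comp P) + B.comp (S.comp Q)) w).fst = S w.fst := by
      simp [A, B, E, P, Q]
    rw [this]
    exact hS w.fst
  · have : ((A.comp (S.comp P) + B.comp (S.comp Q)) w).snd = S w.snd := by
      simp [A, B, E, P, Q]
    rw [this]
    exact hS w.snd
  · exact ((hSc.comp_clm P).clm_comp A).add ((hSc.comp_clm Q).clm_comp B)
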